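/- Let $\mathbb{F}_q$ be a finite field with $q$ elements, $A=\mathbb{F}_q[T]$, $F=\mathrm{Frac}(A)$, let $k$ be a finite extension of $\mathbb{F}_q$ with an $\mathbb{F}_q$-algebra homomorphism $\gamma:A\to k$, and put $\mathfrak{p}=\ker\gamma$. Let $k\{\tau\}$ be the ring of twisted polynomials, $\tau c=c^q\tau$ for $c\in k$, and let $\phi:A\to k\{\tau\}$, $a\mapsto\phi_a$, be a Drinfeld module of rank $r\ge 1$ over $k$, i.e. an $\mathbb{F}_q$-algebra homomorphism with $\phi_T=\gamma(T)+g_1\tau+\cdots+g_r\tau^r$, $g_r\neq 0$. Let $\mathcal{E}=\mathrm{End}_k(\phi)=\{u\in k\{\tau\} : u\phi_T=\phi_Tu\}$, an $A$-algebra via $\phi$, and $\pi=\tau^{[k:\mathbb{F}_q]}\in\mathcal{E}$. Assume that the subfield $K=F(\pi)$ of $\mathcal{E}\otimes_AF$ satisfies $[K:F]=r$. Let $\mathfrak{l}\neq\mathfrak{p}$ be a nonzero prime ideal of $A$, with generator $l$, let $A_{\mathfrak{l}}$ be the completion of $A$ at $\mathfrak{l}$, and let $T_{\mathfrak{l}}(\phi)=\varprojlim_n\phi[\mathfrak{l}^n]$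 be the $\mathfrak{l}$-adic Tate module, where $\phi[\mathfrak{l}^n]\subset\bar k$ is the kernel of $\phi_{l^n}$ and the transition maps are given by $\phi_l$. Assume that $T_{\mathfrak{l}}(\phi)$ is a free module of rank $1$ over $\mathcal{E}_{\mathfrak{l}}=\mathcal{E}\otimes_AA_{\mathfrak{l}}$. Then there are monic polynomials $b_1\mid b_2\mid\cdots\mid b_{r-1}$ in $A$ with $\mathcal{E}/A[\pi]\cong A/b_1A\times\cdots\times A/b_{r-1}A$ as $A$-modules, and monic polynomials $f_i(x)=x^i+\sum_{j<i}a_{ij}x^j\in A[x]$, $1\le i\le r-1$, such that $$1,\ \frac{f_1(\pi)}{b_1},\ \dots,\ \frac{f_{r-1}(\pi)}{b_{r-1}}$$ is an $A$-basis of $\mathcal{E}$. Moreover, for every choice of such $b_i$ and $f_i$, let $\mathcal{F}_k\in\mathrm{Mat}_r(A)$ be the matrix of multiplication by $\pi$ on $\mathcal{E}$ in this basis (its columns are the coordinates of the images of the basis elements), and let $P(x)=x^r+c_{r-1}x^{r-1}+\cdots+c_0$ be the minimal polynomial of $\pi$ over $A$. Then: 1. $\mathcal{F}_k$ has the form $$\mathcal{F}_k=\begin{bmatrix}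 -a_{10} & \ast & \cdots & \ast & \ast\\ b_1 & a_{10}-a_{21} & \cdots & \ast & \ast\\ 0 & \frac{b_2}{b_1} & a_{21}-a_{32} & \ast & \ast\\ \vdots & & \ddots & & \\ 0 & 0 & \cdots & \frac{b_{r-1}}{b_{r-2}} & a_{r-1,r-2}-c_{r-1}\end{bmatrix}$$ (for $r=1$ this means $\mathcal{F}_k=[-c_0]$); 2. there is an $A_{\mathfrak{l}}$-basis of $T_{\mathfrak{l}}(\phi)$ with respect to which the action of the arithmetic Frobenius $\mathrm{Frob}_k\in\mathrm{Gal}(\bar k/k)$, $x\mapsto x^{\#k}$, on $T_{\mathfrak{l}}(\phi)$ is given by the matrix $\mathcal{F}_k$. -/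

import Mathlib

open scoped Polynomial TensorProduct

noncomputable section

/-- The action of `ℕ` on `k` in which `n` acts as `c ↦ c ^ (q ^ n)`, where `q = #Fq`. -/
@[reducible]
def frobeniusAction (Fq k : Type*) [Field Fq] [Fintype Fq] [Field k] [Algebra Fq k] :
    MulSemiringAction (Multiplicative ℕ) k where
  smul n c := ((FiniteField.frobeniusAlgHom Fq k) ^ (Multiplicative.toAdd n)) c
  one_smul _ := rfl
  mul_smul m n c := by
    change ((FiniteField.frobeniusAlgHom Fq k) ^ (Multiplicative.toAdd m + Multiplicative.toAdd n)) c
      = _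
    rw [pow_add]
    rfl
  smul_zero _ := map_zero _
  smul_add _ := map_add _
  smul_one _ := map_one _
  smul_mul _ := map_mul _

/-- The ring `k{τ}` of twisted polynomials, with the commutation rule `τ c = c ^ q τ`. -/
def TwistedPoly (Fq k : Type*) [Field Fq] [Fintype Fq] [Field k] [Algebra Fq k] : Type _ :=
  SkewPolynomial k

namespace TwistedPoly

variable {Fq k : Type*} [Field Fq] [Fintype Fq] [Field k] [Algebra Fq k]

instance instRing : Ring (TwistedPoly Fq k) :=
  @SkewMonoidAlgebra.instRing k (Multiplicative ℕ) _ _ (frobeniusAction Fq k)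

instance instAlgebra : Algebra Fq (TwistedPoly Fq k) :=
  @SkewMonoidAlgebra.instAlgebraOfSMulCommClass Fq (Multiplicative ℕ) _ _ k _ _ (frobeniusAction Fq k)
    (@SMulCommClass.mk (Multiplicative ℕ) Fq k (frobeniusAction Fq k).toSMul _
      (fun n a c => map_smul ((FiniteField.frobeniusAlgHom Fq k) ^ (Multiplicative.toAdd n)) a c))

/-- The coefficient of `τ ^ n`, coefficients being written on the left of the powers of `τ`. -/
def coeff (u : TwistedPoly Fq k) (n : ℕ) : k := SkewPolynomial.coeff u n

variable (Fq k) in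
/-- The indeterminate `τ`. -/
def tau : TwistedPoly Fq k := (SkewPolynomial.X : SkewPolynomial k)

theorem frobenius_pow_apply (Fq : Type*) {R : Type*} [Field Fq] [Fintype Fq] [CommRing R]
    [Algebra Fq R] (m : ℕ) (z : R) :
    ((FiniteField.frobeniusAlgHom Fq R) ^ m) z = z ^ (Fintype.card Fq ^ m) := by
  induction m with
  | zero => simp
  | succ m ih => rw [pow_succ', AlgHom.mul_apply, ih]; simp [pow_succ, pow_mul]

theorem frobenius_toLinearMap_pow_apply (Fq : Type*) {R : Type*} [Field Fq] [Fintype Fq]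
    [CommRing R] [Algebra Fq R] (m : ℕ) (z : R) :
    ((FiniteField.frobeniusAlgHom Fq R).toLinearMap ^ m) z = z ^ (Fintype.card Fq ^ m) := by
  induction m with
  | zero => simp
  | succ m ih => rw [pow_succ', Module.End.mul_apply, ih]; simp [pow_succ, pow_mul]

variable (Fq k) in
/-- `k{τ}` acts on the algebraic closure of `k`: the element `∑ cᵢ τ ^ i` acts as the
`Fq`-linear map `x ↦ ∑ cᵢ x ^ (q ^ i)`. -/
def evalHom : TwistedPoly Fq k →+* Module.End Fq (AlgebraicClosure k) :=
  letI := frobeniusAction Fq k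
  SkewMonoidAlgebra.liftNCRingHom (k := k) (G := Multiplicative ℕ)
    (((Algebra.lmul Fq (AlgebraicClosure k) :
        AlgebraicClosure k →ₐ[Fq] Module.End Fq (AlgebraicClosure k)) :
        AlgebraicClosure k →+* Module.End Fq (AlgebraicClosure k)).comp
      (algebraMap k (AlgebraicClosure k)))
    (powersHom _ (FiniteField.frobeniusAlgHom Fq (AlgebraicClosure k)).toLinearMap)
    (by
      intro c n
      have h : n • c = c ^ (Fintype.card Fq ^ (Multiplicative.toAdd n)) :=
        frobenius_pow_apply Fq _ c
      ext z
      simp [h, frobenius_toLinearMap_pow_apply, powersHom_apply, mul_pow])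

theorem evalHom_single (n : Multiplicative ℕ) (c : k) (z : AlgebraicClosure k) :
    evalHom Fq k (SkewMonoidAlgebra.single n c : SkewMonoidAlgebra k (Multiplicative ℕ)) z =
      algebraMap k (AlgebraicClosure k) c * z ^ (Fintype.card Fq ^ (Multiplicative.toAdd n)) := by
  let _ := frobeniusAction Fq k
  have h : evalHom Fq k (SkewMonoidAlgebra.single n c : SkewMonoidAlgebra k (Multiplicative ℕ)) =
      _ * _ := SkewMonoidAlgebra.liftNC_single _ _ n c
  rw [h, Module.End.mul_apply]
  simp [frobenius_toLinearMap_pow_apply, powersHom_apply]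

end TwistedPoly

/-- A Drinfeld `Fq[T]`-module of rank `r ≥ 1` over `k`, where `γ : Fq[T] → k` is the structure map:
an `Fq`-algebra homomorphism `φ : Fq[T] → k{τ}` with `φ_T = γ(T) + g₁ τ + ⋯ + g_r τ ^ r` and
`g_r ≠ 0`. -/
structure DrinfeldModule {Fq k : Type*} [Field Fq] [Fintype Fq] [Field k] [Algebra Fq k]
    (γ : Fq[X] →ₐ[Fq] k) (r : ℕ) where
  toAlgHom : Fq[X] →ₐ[Fq] TwistedPoly Fq k
  one_le_rank : 1 ≤ r
  coeff_zero : (toAlgHom Polynomial.X).coeff 0 = γ Polynomial.X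
  coeff_rank_ne_zero : (toAlgHom Polynomial.X).coeff r ≠ 0
  coeff_eq_zero : ∀ i, r < i → (toAlgHom Polynomial.X).coeff i = 0

namespace DrinfeldModule

variable {Fq k : Type*} [Field Fq] [Fintype Fq] [Field k] [Algebra Fq k]
  {γ : Fq[X] →ₐ[Fq] k} {r : ℕ} (φ : DrinfeldModule γ r)

/-- The endomorphism ring `{u ∈ k{τ} | u φ_T = φ_T u}`. -/
abbrev endRing : Subalgebra Fq (TwistedPoly Fq k) :=
  Subalgebra.centralizer Fq {φ.toAlgHom Polynomial.X}

theorem commute_of_mem_endRing {u : TwistedPoly Fq k} (hu : u ∈ φ.endRing) (a : Fq[X]) :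
    Commute (φ.toAlgHom a) u := by
  have hX : Commute (φ.toAlgHom Polynomial.X) u :=
    (Subalgebra.mem_centralizer_iff Fq).1 hu _ rfl
  induction a using Polynomial.induction_on' with
  | add p q hp hq => rw [map_add]; exact hp.add_left hq
  | monomial n c =>
    rw [← Polynomial.C_mul_X_pow_eq_monomial, map_mul, map_pow, ← Polynomial.algebraMap_eq,
      AlgHom.commutes]
    exact (Algebra.commute_algebraMap_left c u).mul_left (hX.pow_left n)

/-- `φ` as a ring homomorphism into the endomorphism ring. -/
def toEndRing : Fq[X] →+* φ.endRing :=
  (φ.toAlgHom : Fq[X] →+* TwistedPoly Fq k).codRestrict φ.endRing (fun a => by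
    refine (Subalgebra.mem_centralizer_iff Fq).2 ?_
    rintro g rfl
    change φ.toAlgHom _ * φ.toAlgHom a = φ.toAlgHom a * φ.toAlgHom _
    rw [← map_mul, ← map_mul, mul_comm])

/-- The endomorphism ring is an algebra over `A = Fq[T]` via `φ`. -/
instance instAlgebraEndRing : Algebra Fq[X] φ.endRing :=
  φ.toEndRing.toAlgebra' (fun a u => Subtype.ext (φ.commute_of_mem_endRing u.2 a))

/-- The Frobenius endomorphism `π = τ ^ [k : Fq]`. -/
def frobenius [Fintype k] : φ.endRing :=
  ⟨TwistedPoly.tau Fq k ^ Module.finrank Fq k, by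
    let _ := frobeniusAction Fq k
    refine (Subalgebra.mem_centralizer_iff Fq).2 ?_
    rintro g rfl
    have hfix : ∀ c : k, (SkewPolynomial.φ (R := k))^[Module.finrank Fq k] c = c := by
      intro c
      have h1 : (SkewPolynomial.φ : k →+* k)
          = ((FiniteField.frobeniusAlgHom Fq k : k →ₐ[Fq] k) : k →+* k) := by
        ext c
        change ((FiniteField.frobeniusAlgHom Fq k) ^ 1) c = _
        rw [pow_one]; rfl
      rw [h1]
      change (FiniteField.frobeniusAlgHom Fq k)^[Module.finrank Fq k] c = c
      rw [FiniteField.coe_frobeniusAlgHom, pow_iterate]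
      change c ^ (Fintype.card Fq ^ Module.finrank Fq k) = c
      rw [← Module.card_eq_pow_finrank, FiniteField.pow_card]
    have h : ∀ p : SkewPolynomial k,
        SkewPolynomial.X ^ Module.finrank Fq k * p = p * SkewPolynomial.X ^ Module.finrank Fq k := by
      intro p
      rw [SkewPolynomial.X_pow_mul]
      simp only [hfix, SkewPolynomial.sum_monomial]
    exact (h _).symm⟩

/-- The standing assumption `[K : F] = r`: here `F = Frac A`, `D = F ⊗ End(φ)`, and `K = F[π]` is
the `F`-subalgebra of `D` generated by `π` (it is a field, hence equal to `F(π)`). -/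
def FrobeniusDegreeEqRank [Fintype k] : Prop :=
  Module.finrank (FractionRing Fq[X])
    (Algebra.adjoin (FractionRing Fq[X])
      {((1 : FractionRing Fq[X]) ⊗ₜ[Fq[X]] φ.frobenius :
        FractionRing Fq[X] ⊗[Fq[X]] φ.endRing)}) = r

/-- The suborder `A[π]` of the endomorphism ring. -/
abbrev frobeniusOrder [Fintype k] : Subalgebra Fq[X] φ.endRing :=
  Algebra.adjoin Fq[X] {φ.frobenius}

/-- `(b 1, …, b (r - 1))` is the Frobenius index of `φ`: monic polynomials with
`b 1 ∣ ⋯ ∣ b (r - 1)` and `End(φ) / A[π] ≅ A / b 1 × ⋯ × A / b (r - 1)` as `A`-modules. -/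
structure IsFrobeniusIndex [Fintype k] (b : ℕ → Fq[X]) : Prop where
  monic : ∀ i, 1 ≤ i → i < r → (b i).Monic
  dvd : ∀ i j, 1 ≤ i → i ≤ j → j < r → b i ∣ b j
  quotient : Nonempty ((φ.endRing ⧸ Subalgebra.toSubmodule φ.frobeniusOrder) ≃ₗ[Fq[X]]
    ((i : Finset.Ico 1 r) → Fq[X] ⧸ Ideal.span {b i}))

/-- `e = (1, f 1 (π) / b 1, …, f (r - 1) (π) / b (r - 1))` is an `A`-basis of the endomorphism ring,
where `(b 1, …, b (r - 1))` is the Frobenius index and `f i` is monic of degree `i` over `A`.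
By convention `b 0 = 1` and `f 0 = 1`; the values of `b` and `f` from `r` on are irrelevant. -/
structure IsFrobeniusBasis [Fintype k] (b : ℕ → Fq[X]) (f : ℕ → Fq[X][X])
    (e : Module.Basis (Fin r) Fq[X] φ.endRing) : Prop where
  index : φ.IsFrobeniusIndex b
  b_zero : b 0 = 1
  f_zero : f 0 = 1
  f_monic : ∀ i, 1 ≤ i → i < r → (f i).Monic
  f_natDegree : ∀ i, 1 ≤ i → i < r → (f i).natDegree = i
  basis_eq : ∀ i : Fin r, b i • e i = Polynomial.aeval φ.frobenius (f i)

/-- The matrix of multiplication by `π` on the endomorphism ring in the `A`-basis `e`. -/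
def frobeniusMatrix [Fintype k] (e : Module.Basis (Fin r) Fq[X] φ.endRing) :
    Matrix (Fin r) (Fin r) Fq[X] :=
  LinearMap.toMatrix e e (LinearMap.mulLeft Fq[X] φ.frobenius)

/-- The displayed shape of the matrix `𝓕_k`. Write `aᵢⱼ` for the coefficients of `f i` and `cᵢ` for
those of the minimal polynomial of `π` over `A`. Rows and columns are numbered from `0`. -/
structure HasFrobeniusShape [Fintype k] (b : ℕ → Fq[X]) (f : ℕ → Fq[X][X])
    (M : Matrix (Fin r) (Fin r) Fq[X]) : Prop where
  /-- the entries below the subdiagonal vanish -/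
  below : ∀ i j : Fin r, (j : ℕ) + 1 < i → M i j = 0
  /-- the subdiagonal entries are `b (j + 1) / b j` (so the first one is `b 1`) -/
  subdiagonal : ∀ i j : Fin r, (j : ℕ) + 1 = i → b j * M i j = b i
  /-- the diagonal entries are `-a₁₀, a₁₀ - a₂₁, …, a_{r-1,r-2} - c_{r-1}` -/
  diagonal : ∀ i : Fin r, M i i =
    (if (i : ℕ) = 0 then 0 else (f i).coeff (i - 1)) -
    (if (i : ℕ) + 1 < r then (f (i + 1)).coeff i
      else (minpoly Fq[X] φ.frobenius).coeff i)

/-- The algebraic closure of `k`, with the `A`-module structure in which `a` acts as `φ_a`. -/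
def Kbar (_ : DrinfeldModule γ r) : Type _ := AlgebraicClosure k

instance instAddCommGroupKbar : AddCommGroup φ.Kbar := inferInstanceAs (AddCommGroup (AlgebraicClosure k))

/-- The action of the endomorphism ring on the algebraic closure of `k`. -/
def endHom : φ.endRing →+* AddMonoid.End φ.Kbar :=
  ((Module.toAddMonoidEnd (Module.End Fq (AlgebraicClosure k)) (AlgebraicClosure k)).comp
    (TwistedPoly.evalHom Fq k)).comp φ.endRing.val.toRingHom

instance instModuleEndRingKbar : Module φ.endRing φ.Kbar := Module.compHom _ φ.endHom

instance instModuleKbar : Module Fq[X] φ.Kbar := Module.compHom _ φ.toEndRing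

instance instIsScalarTowerKbar : IsScalarTower Fq[X] φ.endRing φ.Kbar where
  smul_assoc a u x := by
    rw [Algebra.smul_def, mul_smul]
    rfl

/-- The completion `A_𝔩` of `A` at the prime `𝔩` generated by `l`. -/
def completion {Fq : Type*} [Field Fq] (l : Fq[X]) : Type _ :=
  AdicCompletion (Ideal.span {l}) Fq[X]

instance instCommRingCompletion {Fq : Type*} [Field Fq] (l : Fq[X]) : CommRing (completion l) :=
  inferInstanceAs (CommRing (AdicCompletion (Ideal.span {l}) Fq[X]))

instance instAlgebraCompletion {Fq : Type*} [Field Fq] (l : Fq[X]) : Algebra Fq[X] (completion l) :=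
  inferInstanceAs (Algebra Fq[X] (AdicCompletion (Ideal.span {l}) Fq[X]))

/-- The residue map `A_𝔩 → A / 𝔩 ^ n`. -/
def residue {Fq : Type*} [Field Fq] (l : Fq[X]) (n : ℕ) :
    completion l →ₐ[Fq[X]] Fq[X] ⧸ Ideal.span {l} ^ n :=
  AdicCompletion.evalₐ (Ideal.span {l}) n

/-- The `𝔩`-adic Tate module: the inverse limit of the torsion modules `φ[𝔩 ^ n]` under the maps
`φ_l : φ[𝔩 ^ (n + 1)] → φ[𝔩 ^ n]`, where `l` is the given generator of `𝔩`. -/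
def TateModule (l : Fq[X]) : Submodule Fq[X] (ℕ → φ.Kbar) where
  carrier := {x | (∀ n, l ^ n • x n = 0) ∧ ∀ n, l • x (n + 1) = x n}
  add_mem' hx hy :=
    ⟨fun n => by simp [hx.1 n, hy.1 n], fun n => by simp [hx.2 n, hy.2 n]⟩
  zero_mem' := ⟨fun n => by simp, fun n => by simp⟩
  smul_mem' c x hx :=
    ⟨fun n => by rw [Pi.smul_apply, smul_comm, hx.1 n, smul_zero],
      fun n => by rw [Pi.smul_apply, smul_comm, hx.2 n]; rfl⟩

/-- An element of `A` with the same residue modulo `l ^ n` as `a ∈ A_𝔩`. -/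
def approx {Fq : Type*} [Field Fq] {l : Fq[X]} (a : completion l) (n : ℕ) : Fq[X] :=
  (Ideal.Quotient.mk_surjective (residue l n a)).choose

theorem mk_approx {Fq : Type*} [Field Fq] {l : Fq[X]} (a : completion l) (n : ℕ) :
    Ideal.Quotient.mk (Ideal.span {l} ^ n) (approx a n) = residue l n a :=
  (Ideal.Quotient.mk_surjective (residue l n a)).choose_spec

variable {φ} {l : Fq[X]}

theorem smul_eq_of_mk_eq {n : ℕ} {x : φ.Kbar} (hx : l ^ n • x = 0) {c d : Fq[X]}
    (h : Ideal.Quotient.mk (Ideal.span {l} ^ n) c = Ideal.Quotient.mk (Ideal.span {l} ^ n) d) :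
    c • x = d • x := by
  rw [Ideal.Quotient.eq, Ideal.span_singleton_pow, Ideal.mem_span_singleton'] at h
  obtain ⟨m, hm⟩ := h
  rw [← sub_eq_zero, ← sub_smul, ← hm, mul_smul, hx, smul_zero]

theorem mk_approx_succ {Fq : Type*} [Field Fq] {l : Fq[X]} (a : completion l) (n : ℕ) :
    Ideal.Quotient.mk (Ideal.span {l} ^ n) (approx a (n + 1)) = residue l n a := by
  have h := mk_approx a (n + 1)
  have hle : Ideal.span {l} ^ (n + 1) ≤ Ideal.span {l} ^ n := Ideal.pow_le_pow_right (Nat.le_succ n)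
  have h2 := congrArg (Ideal.Quotient.factor hle) h
  rw [Ideal.Quotient.factor_mk] at h2
  rw [h2]
  change Ideal.Quotient.factor hle (AdicCompletion.evalₐ (Ideal.span {l}) (n + 1) a) =
    AdicCompletion.evalₐ (Ideal.span {l}) n a
  induction a using AdicCompletion.induction_on with
  | _ f =>
    rw [AdicCompletion.evalₐ_mk, AdicCompletion.evalₐ_mk, Ideal.Quotient.factor_mk,
      Ideal.Quotient.eq]
    have := (f.2 (Nat.le_succ n)).symm
    rw [SModEq.sub_mem] at this
    simpa using this

/-- `a ∈ A_𝔩` acts on the `n`-th component of the Tate module through its residue modulo `l ^ n`. -/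
instance instSMulCompletion : SMul (completion l) (φ.TateModule l) where
  smul a x := ⟨fun n => approx a n • x.1 n,
    fun n => by rw [smul_comm, x.2.1 n, smul_zero],
    fun n => by
      change l • (approx a (n + 1) • x.1 (n + 1)) = _
      rw [smul_comm, x.2.2 n]
      exact smul_eq_of_mk_eq (x.2.1 n) ((mk_approx_succ a n).trans (mk_approx a n).symm)⟩

theorem completion_smul_apply {a : completion l} {x : φ.TateModule l} {n : ℕ} {c : Fq[X]}
    (h : Ideal.Quotient.mk _ c = residue l n a) :
    (a • x).1 n = c • x.1 n :=
  smul_eq_of_mk_eq (x.2.1 n) ((mk_approx a n).trans h.symm)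

instance instModuleCompletion : Module (completion l) (φ.TateModule l) where
  one_smul x := by
    ext n
    rw [completion_smul_apply (c := 1) (by simp), one_smul]
  mul_smul a b x := by
    ext n
    rw [completion_smul_apply (c := approx a n * approx b n) (by simp [mk_approx]), mul_smul]
    rfl
  smul_zero a := by
    ext n
    exact smul_zero (approx a n)
  smul_add a x y := by
    ext n
    exact smul_add (approx a n) _ _
  add_smul a b x := by
    ext n
    rw [completion_smul_apply (c := approx a n + approx b n) (by simp [mk_approx]), add_smul]
    rfl
  zero_smul x := by
    ext n
    rw [completion_smul_apply (c := 0) (by simp), zero_smul]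
    rfl

instance instIsScalarTowerCompletion :
    IsScalarTower Fq[X] (completion l) (φ.TateModule l) where
  smul_assoc c a x := by
    ext n
    rw [completion_smul_apply (c := c * approx a n)
      (by rw [map_mul, mk_approx, Algebra.smul_def, map_mul, AlgHom.commutes]; rfl), mul_smul]
    rfl

/-- The endomorphism ring acts on the Tate module componentwise. -/
instance instModuleEndRingTate : Module φ.endRing (φ.TateModule l) where
  smul u x := ⟨fun n => u • x.1 n,
    fun n => by rw [← algebraMap_smul φ.endRing, ← mul_smul, Algebra.commutes, mul_smul,
      algebraMap_smul, x.2.1 n, smul_zero],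
    fun n => by
      change l • (u • x.1 (n + 1)) = _
      rw [← algebraMap_smul φ.endRing, ← mul_smul, Algebra.commutes, mul_smul,
        algebraMap_smul, x.2.2 n]⟩
  one_smul x := by ext n; exact one_smul φ.endRing (x.1 n)
  mul_smul u v x := by ext n; exact mul_smul u v (x.1 n)
  smul_zero u := by ext n; exact smul_zero u
  smul_add u x y := by ext n; exact smul_add u (x.1 n) (y.1 n)
  add_smul u v x := by ext n; exact add_smul u v (x.1 n)
  zero_smul x := by ext n; exact zero_smul φ.endRing (x.1 n)

instance instIsScalarTowerTate : IsScalarTower Fq[X] φ.endRing (φ.TateModule l) where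
  smul_assoc c u x := by ext n; exact smul_assoc c u (x.1 n)

instance instSMulCommClassTate : SMulCommClass (completion l) φ.endRing (φ.TateModule l) where
  smul_comm a u x := by
    ext n
    change approx a n • (u • x.1 n) = u • (approx a n • x.1 n)
    rw [← algebraMap_smul φ.endRing, ← mul_smul, Algebra.commutes, mul_smul, algebraMap_smul]

/-- The natural action of `𝓔_𝔩 = A_𝔩 ⊗ End(φ)` on the Tate module. -/
instance instModuleTensorTate :
    Module (completion l ⊗[Fq[X]] φ.endRing) (φ.TateModule l) :=
  TensorProduct.Algebra.module

theorem gal_smul (σ : AlgebraicClosure k ≃ₐ[k] AlgebraicClosure k) (a : Fq[X])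
    (x : φ.Kbar) : (id (σ (id (a • x) : AlgebraicClosure k)) : φ.Kbar) = a • (id (σ x) : φ.Kbar) := by
  have key : ∀ (u : TwistedPoly Fq k) (z : AlgebraicClosure k),
      σ (TwistedPoly.evalHom Fq k u z) = TwistedPoly.evalHom Fq k u (σ z) := by
    intro u z
    induction u using SkewMonoidAlgebra.induction_on with
    | zero =>
      have h0 : TwistedPoly.evalHom Fq k (0 : SkewMonoidAlgebra k (Multiplicative ℕ)) = 0 :=
        map_zero (TwistedPoly.evalHom Fq k)
      rw [h0]; exact map_zero σ
    | single n c =>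
      rw [TwistedPoly.evalHom_single, TwistedPoly.evalHom_single, map_mul, map_pow, σ.commutes]
    | add f g hf hg =>
      have h0 : TwistedPoly.evalHom Fq k (f + g : SkewMonoidAlgebra k (Multiplicative ℕ)) =
          TwistedPoly.evalHom Fq k f + TwistedPoly.evalHom Fq k g :=
        map_add (TwistedPoly.evalHom Fq k) _ _
      rw [h0, LinearMap.add_apply, LinearMap.add_apply, map_add, hf, hg]
  exact key _ _

variable (φ l) in
/-- The action of the Galois group of `k` on the Tate module, componentwise. -/
def galTate (σ : AlgebraicClosure k ≃ₐ[k] AlgebraicClosure k) :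
    φ.TateModule l →ₗ[completion l] φ.TateModule l where
  toFun x := ⟨fun n => (σ (x.1 n) : AlgebraicClosure k),
    fun n => by
      have h := gal_smul σ (l ^ n) (x.1 n)
      rw [x.2.1 n] at h
      exact h.symm.trans (map_zero σ),
    fun n => by
      have h := gal_smul σ l (x.1 (n + 1))
      rw [x.2.2 n] at h
      exact h.symm⟩
  map_add' x y := by ext n; exact map_add σ _ _
  map_smul' a x := by ext n; exact gal_smul σ (approx a n) (x.1 n)

variable (φ l) in
/-- The arithmetic Frobenius `Frob_k : x ↦ x ^ #k` acting on the Tate module. -/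
def frobTate [Fintype k] : φ.TateModule l →ₗ[completion l] φ.TateModule l :=
  φ.galTate l (FiniteField.frobeniusAlgEquivOfAlgebraic k (AlgebraicClosure k))

end DrinfeldModule

end

/-! Write `E` for the endomorphism ring. The hypothesis `[K : F] = r` says that `1, π, …, π^(r-1)`
are independent over `A` (`eq_zero_of_finrank_adjoin_eq`), so `E` has rank at least `r`. Conversely,
the Tate module `T` has the same rank over `A_𝔩` as `E` over `A`, because it is free of rank one
over `E_𝔩`; and `T / lT` embeds in `φ[𝔩]`, which has at most `q^(r deg l)` elements
(`finrank_endRing_le`). Hence `E`, finite and torsion-free over `A`, has rank exactly `r`, and the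
minimal polynomial of `π` has degree `r`.

The basis is a Hermite normal form (`exists_triangular_basis`). Fix a common denominator `d` for `E`
relative to the powers of `π`. The elements `g(π) / d` of `E` with `deg g ≤ i` have leading
coefficients forming an ideal `(m_i)`; put `b_i = d / m_i`. Multiplication by `π` gives `m_(i+1) ∣
m_i`, hence `b_i ∣ b_(i+1)`, and an induction shows that `b_i` alone already clears the denominators
in degree at most `i`. In such a basis `A[π]` consists of the elements whose `i`-th coordinate is
divisible by `b_i`, which gives the quotient.

For the matrix, `b_j π e_j = f_(j+1)(π) + (x f_j - f_(j+1))(π)`: the first term is `b_(j+1)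
e_(j+1)`, the second has degree at most `j`, and its coefficient at `x^j` gives the diagonal entry.
In the last column the minimal polynomial replaces `f_(j+1)`. Finally `Frob_k` acts on `T` as `π`,
so transporting the basis `1 ⊗ e_i` of `E_𝔩` to `T` gives the same matrix. -/

noncomputable section

/-! ### Orders containing the powers of one element: denominators and triangular bases. -/

section PowersOfElement

open Polynomial

variable {K E : Type*} [Field K] [Ring E] [Algebra K[X] E] {p : E} {r : ℕ}

theorem degree_X_mul_le {R : Type*} [CommRing R] {g : R[X]} {i : ℕ} (hg : g.degree ≤ (i : ℕ)) :
    (X * g).degree ≤ ((i + 1 : ℕ) : WithBot ℕ) := by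
  refine (degree_mul_le _ _).trans ?_
  rw [add_comm, Nat.cast_add]
  exact add_le_add hg degree_X_le

theorem degree_le_of_degree_le_succ {R : Type*} [CommRing R] {g : R[X]} {i : ℕ}
    (hg : g.degree ≤ ((i + 1 : ℕ) : WithBot ℕ)) (h : g.coeff (i + 1) = 0) :
    g.degree ≤ (i : ℕ) := by
  rw [degree_le_iff_coeff_zero] at hg ⊢
  intro m hm
  have hm' : i < m := by exact_mod_cast hm
  rcases Nat.lt_or_ge (i + 1) m with h1 | h1
  · exact hg m (by exact_mod_cast h1)
  · rwa [show m = i + 1 by omega]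

theorem degree_le_of_degree_lt_succ {R : Type*} [CommRing R] {g : R[X]} {i : ℕ}
    (hg : g.degree < ((i + 1 : ℕ) : WithBot ℕ)) : g.degree ≤ (i : ℕ) := by
  rw [degree_lt_iff_coeff_zero] at hg
  rw [degree_le_iff_coeff_zero]
  intro n hn
  exact hg n (by exact_mod_cast hn)

theorem degree_sub_coeff_smul_lt {R : Type*} [CommRing R] {f g : R[X]} {m : ℕ} (hf : f.Monic)
    (hfm : f.natDegree = m) (hg : g.degree ≤ (m : ℕ)) :
    (g - g.coeff m • f).degree < (m : ℕ) := by
  have h1 := hf.coeff_natDegree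
  rw [hfm] at h1
  rw [degree_le_iff_coeff_zero] at hg
  rw [degree_lt_iff_coeff_zero]
  intro n hn
  rcases hn.eq_or_lt with rfl | hn
  · simp [h1]
  · rw [coeff_sub, coeff_smul, hg n (by exact_mod_cast hn),
      coeff_eq_zero_of_natDegree_lt (p := f) (by rw [hfm]; exact hn)]
    simp

theorem exists_monic_generator {I : Ideal K[X]} (hI : I ≠ ⊥) :
    ∃ m : K[X], m.Monic ∧ m ∈ I ∧ ∀ c ∈ I, m ∣ c := by
  classical
  obtain ⟨a, ha⟩ := (IsPrincipalIdealRing.principal I).principal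
  have ha0 : a ≠ 0 := by
    rintro rfl
    exact hI (by rw [ha]; simp)
  have hI' : I = Ideal.span {a} := ha
  refine ⟨normalize a, monic_normalize ha0, ?_, fun c hc => ?_⟩
  · rw [hI', Ideal.mem_span_singleton]
    exact (normalize_associated a).symm.dvd
  · rw [hI', Ideal.mem_span_singleton] at hc
    exact (normalize_associated a).dvd.trans hc

/-- In a nonzero torsion-free finite algebra over a principal ideal domain, the base ring is
saturated. -/
theorem dvd_of_smul_eq_smul_one [Module.Finite K[X] E] [Module.IsTorsionFree K[X] E] [Nontrivial E]
    {d c : K[X]} (hd : d ≠ 0) {u : E} (h : d • u = c • (1 : E)) : d ∣ c := by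
  classical
  obtain ⟨d', hd'⟩ := EuclideanDomain.gcd_dvd_left d c
  obtain ⟨c', hc'⟩ := EuclideanDomain.gcd_dvd_right d c
  set g := EuclideanDomain.gcd d c with hg
  have hbez : g = d * EuclideanDomain.gcdA d c + c * EuclideanDomain.gcdB d c :=
    EuclideanDomain.gcd_eq_gcd_ab d c
  have hg0 : g ≠ 0 := by
    intro h0
    rw [h0, zero_mul] at hd'
    exact hd hd'
  set α := EuclideanDomain.gcdA d c
  set β := EuclideanDomain.gcdB d c
  have hone : d' * α + c' * β = 1 := by
    apply mul_left_cancel₀ hg0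
    rw [mul_one]
    conv_rhs => rw [hbez]
    rw [mul_add, ← mul_assoc, ← mul_assoc, ← hd', ← hc']
  have hu : d' • u = c' • (1 : E) := by
    apply smul_right_injective E hg0
    simp only [smul_smul]
    rw [← hd', ← hc', h]
  -- Once the gcd is divided out, Bézout makes `d'` invertible in `E`. Multiplying a basis vector by
  -- the inverse and reading its own coordinate shows that `d'` is a unit of the base ring.
  have hw : d' • (α • (1 : E) + β • u) = 1 := by
    rw [smul_add, smul_comm d' β u, hu, smul_smul, smul_smul, ← add_smul, mul_comm β, hone,
      one_smul]
  let B := Module.Free.chooseBasis K[X] E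
  obtain ⟨j⟩ : Nonempty (Module.Free.ChooseBasisIndex K[X] E) := B.index_nonempty
  have hdvd : d' ∣ 1 := by
    refine ⟨B.repr ((α • (1 : E) + β • u) * B j) j, ?_⟩
    have := congrArg (fun x : E => B.repr (x * B j) j) hw
    simpa only [smul_mul_assoc, one_mul, map_smul, Finsupp.smul_apply, smul_eq_mul,
      B.repr_self, Finsupp.single_eq_same] using this.symm
  rw [hd', hc']
  exact mul_dvd_mul_left g (hdvd.trans (one_dvd _))

/-- The span of `1, p, …, p^(r-1)` has full rank, so the quotient by it is finitely generated and
torsion, and a single nonzero scalar annihilates it. -/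
theorem exists_common_denominator [Module.Finite K[X] E]
    (hr : Module.finrank K[X] E = r)
    (hp : ∀ g : K[X][X], g.degree < r → aeval p g = 0 → g = 0) :
    ∃ d : K[X], d ≠ 0 ∧ ∀ u : E, ∃ g : K[X][X], g.degree < r ∧ d • u = aeval p g := by
  let T : K[X][X] →ₗ[K[X]] E := (aeval p).toLinearMap
  let N : Submodule K[X] E := (degreeLT K[X] r).map T
  have hinj : Function.Injective (T.domRestrict (degreeLT K[X] r)) := by
    rw [injective_iff_map_eq_zero]
    rintro ⟨g, hg⟩ h
    exact Subtype.ext (hp g (mem_degreeLT.1 hg) h)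
  have hN : Module.finrank K[X] N = r := by
    have e1 := LinearEquiv.ofInjective _ hinj
    rw [LinearMap.range_domRestrict] at e1
    rw [← e1.finrank_eq, (degreeLTEquiv K[X] r).finrank_eq]
    simp
  have h0 : Module.finrank K[X] (E ⧸ N) = 0 := by
    have := Submodule.finrank_quotient_add_finrank N
    omega
  rw [Module.finrank_eq_zero_iff_isTorsion] at h0
  obtain ⟨d, hd, hd'⟩ := Submodule.annihilator_top_inter_nonZeroDivisors h0
  refine ⟨d, nonZeroDivisors.ne_zero hd', fun u => ?_⟩
  have := (Submodule.mem_annihilator.1 hd) (Submodule.Quotient.mk u) trivial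
  rw [← Submodule.Quotient.mk_smul, Submodule.Quotient.mk_eq_zero] at this
  obtain ⟨g, hg, hg'⟩ := this
  exact ⟨g, mem_degreeLT.1 hg, hg'.symm⟩

/-- Among the elements whose `d`-multiple is a polynomial of degree at most `i` in `p`, one has a
leading coefficient dividing all the others. -/
theorem exists_minimal_leading_coeff {d : K[X]} (hd : d ≠ 0) (i : ℕ) :
    ∃ (m : K[X]) (e : E) (g : K[X][X]), m.Monic ∧ g.degree ≤ (i : ℕ) ∧ d • e = aeval p g ∧
      g.coeff i = m ∧
      ∀ (u : E) (h : K[X][X]), h.degree ≤ (i : ℕ) → d • u = aeval p h → m ∣ h.coeff i := by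
  let I : Ideal K[X] :=
    { carrier := {c | ∃ (u : E) (g : K[X][X]), g.degree ≤ (i : ℕ) ∧ d • u = aeval p g ∧ g.coeff i = c}
      add_mem' := by
        rintro _ _ ⟨u, g, h1, h2, rfl⟩ ⟨u', g', h1', h2', rfl⟩
        exact ⟨u + u', g + g', (degree_add_le _ _).trans (max_le h1 h1'),
          by rw [smul_add, h2, h2', map_add], coeff_add _ _ _⟩
      zero_mem' := ⟨0, 0, by simp, by simp, by simp⟩
      smul_mem' := by
        rintro c _ ⟨u, g, h1, h2, rfl⟩
        exact ⟨c • u, c • g, (degree_smul_le _ _).trans h1,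
          by rw [smul_comm, h2, map_smul], coeff_smul _ _ _⟩ }
  -- The element `p ^ i` itself shows that the ideal of leading coefficients is nonzero and that its
  -- generator divides `d`.
  have hdI : d ∈ I := by
    refine ⟨p ^ i, C d * X ^ i, degree_C_mul_X_pow_le _ _, ?_, by simp⟩
    simp [Algebra.smul_def]
  obtain ⟨m, hm, ⟨e, g, h1, h2, h3⟩, hm2⟩ := exists_monic_generator
    (I := I) (fun h => hd (by rw [h] at hdI; simpa using hdI))
  exact ⟨m, e, g, hm, h1, h2, h3, fun u h hh hu => hm2 _ ⟨u, h, hh, hu, rfl⟩⟩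

/-- Hermite reduction along the filtration by degree in `p`. The extra content is that the
denominators form a divisibility chain and that each numerator can be made monic; both use that `E`
is stable under multiplication by `p`. -/
theorem exists_triangular_basis [Module.Finite K[X] E] [Module.IsTorsionFree K[X] E] [Nontrivial E]
    (hr : Module.finrank K[X] E = r) (hr1 : 1 ≤ r)
    (hp : ∀ g : K[X][X], g.degree < r → aeval p g = 0 → g = 0) :
    ∃ (b : ℕ → K[X]) (f : ℕ → K[X][X]) (e : Module.Basis (Fin r) K[X] E),
      b 0 = 1 ∧ f 0 = 1 ∧ (∀ i < r, (b i).Monic) ∧ (∀ i, i + 1 < r → b i ∣ b (i + 1)) ∧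
      (∀ i < r, (f i).Monic) ∧ (∀ i < r, (f i).natDegree = i) ∧
      ∀ i : Fin r, b i • e i = aeval p (f i) := by
  obtain ⟨d₀, hd₀, hden₀⟩ := exists_common_denominator hr hp
  obtain ⟨d, hdm, hd, hden⟩ : ∃ d : K[X], d.Monic ∧ d ≠ 0 ∧
      ∀ u : E, ∃ g : K[X][X], g.degree < r ∧ d • u = aeval p g := by
    classical
    refine ⟨normalize d₀, monic_normalize hd₀, (monic_normalize hd₀).ne_zero, fun u => ?_⟩
    obtain ⟨g, hg, hu⟩ := hden₀ u
    obtain ⟨c, hc⟩ := (normalize_associated d₀).symm.dvd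
    exact ⟨c • g, (degree_smul_le _ _).trans_lt hg,
      by rw [hc, mul_comm, mul_smul, hu, map_smul]⟩
  have huniq : ∀ g h : K[X][X], g.degree < r → h.degree < r → aeval p g = aeval p h → g = h := by
    intro g h hg hh hgh
    rw [← sub_eq_zero]
    exact hp _ ((degree_sub_le _ _).trans_lt (max_lt hg hh)) (by rw [map_sub, hgh, sub_self])
  have hlead : ∀ i : ℕ, ∃ (m : K[X]) (e : E) (g : K[X][X]), m.Monic ∧ g.degree ≤ (i : ℕ) ∧
      d • e = aeval p g ∧ g.coeff i = m ∧
      (∀ (u : E) (h : K[X][X]), h.degree ≤ (i : ℕ) → d • u = aeval p h → m ∣ h.coeff i) ∧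
      (i = 0 → m = d ∧ e = 1) := by
    intro i
    rcases Nat.eq_zero_or_pos i with rfl | hi
    -- In degree `0` the generator must be `1`: saturation of the base ring says that every constant
    -- numerator is already divisible by `d`.
    · refine ⟨d, 1, C d, hdm, degree_C_le, by simp [Algebra.smul_def], by simp, ?_, by simp⟩
      intro u h hh hu
      rw [Nat.cast_zero] at hh
      rw [eq_C_of_degree_le_zero hh, aeval_C, Algebra.algebraMap_eq_smul_one] at hu
      exact dvd_of_smul_eq_smul_one hd hu
    · obtain ⟨m, e, g, h1, h2, h3, h4, h5⟩ := exists_minimal_leading_coeff (p := p) hd i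
      exact ⟨m, e, g, h1, h2, h3, h4, h5, fun h => absurd h hi.ne'⟩
  choose m e g hm hgdeg hge hgm hmin hzero using hlead
  have hmd : ∀ i, m i ∣ d := by
    intro i
    have := hmin i (p ^ i) (C d * X ^ i) (degree_C_mul_X_pow_le _ _) (by simp [Algebra.smul_def])
    simpa using this
  choose b hb using hmd
  have hbm : ∀ i, (b i).Monic := fun i => (hm i).of_mul_monic_left (by rw [← hb]; exact hdm)
  -- The product `p * e i` lies in the next step of the filtration with leading coefficient `m i`,
  -- so `m (i + 1)` divides `m i`.
  have hstep : ∀ i, ∃ t, m i = m (i + 1) * t ∧ b (i + 1) = t * b i := by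
    intro i
    have h1 := hmin (i + 1) (p * e i) (X * g i) (degree_X_mul_le (hgdeg i))
      (by rw [← mul_smul_comm, hge, map_mul, aeval_X])
    rw [coeff_X_mul, hgm] at h1
    obtain ⟨t, ht⟩ := h1
    refine ⟨t, ht, mul_left_cancel₀ (hm (i + 1)).ne_zero ?_⟩
    rw [← hb, ← mul_assoc, ← ht, ← hb]
  have hb0 : b 0 = 1 := by
    have h := hb 0
    rw [(hzero 0 rfl).1] at h
    exact mul_left_cancel₀ hd (by rw [← h, mul_one])
  have hclear : ∀ (i : ℕ) (u : E) (h : K[X][X]), h.degree ≤ (i : ℕ) → d • u = aeval p h →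
      ∃ h' : K[X][X], h'.degree ≤ i ∧ b i • u = aeval p h' := by
    intro i
    induction i with
    | zero =>
      intro u h hh hu
      obtain ⟨t, ht⟩ := hmin 0 u h hh hu
      rw [Nat.cast_zero] at hh
      rw [eq_C_of_degree_le_zero hh, ht, (hzero 0 rfl).1, aeval_C, Algebra.algebraMap_eq_smul_one,
        mul_smul] at hu
      refine ⟨C t, degree_C_le, ?_⟩
      rw [hb0, one_smul, aeval_C, Algebra.algebraMap_eq_smul_one]
      exact smul_right_injective E hd hu
    | succ i ih =>
      intro u h hh hu
      obtain ⟨c, hc⟩ := hmin (i + 1) u h hh hu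
      obtain ⟨t, ht, hbt⟩ := hstep i
      -- The leading coefficients `t * m (i + 1) * c` and `c * m i` agree, so the difference drops
      -- to degree `i`, where `b i` clears it. Since `b (i + 1) = t * b i`, this clears `u` up to a
      -- multiple of `p * e i`, which is cleared by `ih` for `e i`.
      obtain ⟨h₁, hh₁, hu₁⟩ := ih (t • u - c • (p * e i)) (t • h - c • (X * g i))
        (degree_le_of_degree_le_succ
          ((degree_sub_le _ _).trans (max_le ((degree_smul_le _ _).trans hh)
            ((degree_smul_le _ _).trans (degree_X_mul_le (hgdeg i)))))
          (by rw [coeff_sub, coeff_smul, coeff_smul, coeff_X_mul, hgm, hc, ht]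
              simp only [smul_eq_mul]; ring))
        (by rw [smul_sub, smul_comm d t, hu, smul_comm d c, ← mul_smul_comm, hge, map_sub,
              map_smul, map_smul, map_mul, aeval_X])
      obtain ⟨h₂, hh₂, hu₂⟩ := ih (e i) (g i) (hgdeg i) (hge i)
      refine ⟨h₁ + c • (X * h₂), (degree_add_le _ _).trans (max_le (hh₁.trans ?_)
        ((degree_smul_le _ _).trans (degree_X_mul_le hh₂))), ?_⟩
      · exact_mod_cast Nat.le_succ i
      · rw [map_add, ← hu₁, map_smul, map_mul, aeval_X, ← hu₂, mul_smul_comm, hbt, smul_sub,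
          smul_comm (b i) c, smul_smul, mul_comm (b i) t, sub_add_cancel]
  have hf : ∀ i, ∃ f : K[X][X], i < r → f.degree ≤ (i : ℕ) ∧ b i • e i = aeval p f ∧ f.coeff i = 1 := by
    intro i
    obtain ⟨f, h1, h2⟩ := hclear i (e i) (g i) (hgdeg i) (hge i)
    refine ⟨f, fun hi => ⟨h1, h2, ?_⟩⟩
    have hir : (i : WithBot ℕ) < r := by exact_mod_cast hi
    -- Both polynomials represent `d • b i • e i` in degree below `r`, hence coincide; comparing
    -- coefficients at `i` and using `d = m i * b i` makes `f` monic.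
    have h3 := huniq (d • f) (b i • g i) ((degree_smul_le _ _).trans_lt (h1.trans_lt hir))
      ((degree_smul_le _ _).trans_lt ((hgdeg i).trans_lt hir))
      (by rw [map_smul, map_smul, ← h2, ← hge, smul_comm])
    have h4 := congrArg (fun q => coeff q i) h3
    simp only [coeff_smul, smul_eq_mul, hgm] at h4
    rw [mul_comm (b i), ← hb] at h4
    exact mul_left_cancel₀ hd (by rw [h4, mul_one])
  choose f hf using hf
  have hspan : ∀ i, i < r → ∀ (u : E) (h : K[X][X]), h.degree ≤ (i : ℕ) → d • u = aeval p h →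
      u ∈ Submodule.span K[X] (Set.range fun j : Fin r => e j) := by
    intro i
    induction i with
    | zero =>
      intro hi u h hh hu
      obtain ⟨t, ht⟩ := hmin 0 u h hh hu
      rw [Nat.cast_zero] at hh
      rw [eq_C_of_degree_le_zero hh, ht, (hzero 0 rfl).1, aeval_C, Algebra.algebraMap_eq_smul_one,
        mul_smul] at hu
      rw [smul_right_injective E hd hu, ← (hzero 0 rfl).2]
      exact Submodule.smul_mem _ _ (Submodule.subset_span ⟨⟨0, hi⟩, rfl⟩)
    | succ i ih =>
      intro hi u h hh hu
      obtain ⟨c, hc⟩ := hmin (i + 1) u h hh hu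
      have h1 := ih (by omega) (u - c • e (i + 1)) (h - c • g (i + 1))
        (degree_le_of_degree_le_succ
          ((degree_sub_le _ _).trans (max_le hh ((degree_smul_le _ _).trans (hgdeg _))))
          (by rw [coeff_sub, coeff_smul, hgm, hc, smul_eq_mul]; ring))
        (by rw [smul_sub, smul_comm, hge, hu, map_sub, map_smul])
      rw [← sub_add_cancel u (c • e (i + 1))]
      exact Submodule.add_mem _ h1
        (Submodule.smul_mem _ _ (Submodule.subset_span ⟨⟨i + 1, hi⟩, rfl⟩))
  have htop : ⊤ ≤ Submodule.span K[X] (Set.range fun j : Fin r => e j) := by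
    intro u _
    obtain ⟨h, hh, hu⟩ := hden u
    refine hspan (r - 1) (by omega) u h ?_ hu
    rw [degree_lt_iff_coeff_zero] at hh
    rw [degree_le_iff_coeff_zero]
    intro n hn
    have hn' : r - 1 < n := by exact_mod_cast hn
    exact hh n (by omega)
  -- As many generators as the rank are automatically independent.
  have hli := linearIndependent_of_top_le_span_of_card_eq_finrank htop (by simp [hr])
  have hbasis : ∀ i : Fin r, Module.Basis.mk hli htop i = e i := fun i =>
    Module.Basis.mk_apply hli htop i
  have hfdeg : ∀ i < r, (f i).natDegree = i := fun i hi =>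
    natDegree_eq_of_le_of_coeff_ne_zero (natDegree_le_of_degree_le (hf i hi).1)
      (by rw [(hf i hi).2.2]; exact one_ne_zero)
  have hf0 : f 0 = 1 := by
    have h1 := (hf 0 (by omega)).1
    rw [Nat.cast_zero] at h1
    rw [eq_C_of_degree_le_zero h1, (hf 0 (by omega)).2.2, C_1]
  refine ⟨b, f, Module.Basis.mk hli htop, hb0, hf0, fun i _ => hbm i, fun i _ => ?_,
    fun i hi => ?_, hfdeg, fun i => ?_⟩
  · obtain ⟨t, -, ht⟩ := hstep i
    exact ⟨t, by rw [ht, mul_comm]⟩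
  · rw [Monic, leadingCoeff, hfdeg i hi, (hf i hi).2.2]
  · rw [hbasis, (hf i i.2).2.1]

/-- If `p` has no relation of degree less than the rank, its minimal polynomial has degree equal to
the rank. -/
theorem natDegree_minpoly_eq_finrank [Module.Finite K[X] E] [Module.IsTorsionFree K[X] E]
    [Nontrivial E]
    (hr : Module.finrank K[X] E = r)
    (hp : ∀ g : K[X][X], g.degree < r → aeval p g = 0 → g = 0) :
    IsIntegral K[X] p ∧ (minpoly K[X] p).natDegree = r := by
  let P := (LinearMap.mulLeft K[X] p).charpoly
  have hP : P.Monic := LinearMap.charpoly_monic _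
  have hPr : P.natDegree = r := by rw [LinearMap.charpoly_natDegree, hr]
  have hP0 : aeval p P = 0 := by
    have h1 := LinearMap.aeval_self_charpoly (LinearMap.mulLeft K[X] p)
    -- Cayley–Hamilton for left multiplication by `p`, evaluated at `1`, gives a monic relation of
    -- degree `r` for `p`.
    have h2 : aeval (LinearMap.mulLeft K[X] p) P = Algebra.lmul K[X] E (aeval p P) :=
      aeval_algHom_apply (Algebra.lmul K[X] E) p P
    have h3 := h2.symm.trans h1
    have h4 := LinearMap.congr_fun h3 1
    simpa using h4
  have hint : IsIntegral K[X] p := ⟨P, hP, by rwa [← aeval_def]⟩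
  refine ⟨hint, le_antisymm ?_ ?_⟩
  · rw [← hPr]
    exact natDegree_le_natDegree (minpoly.min K[X] p hP hP0)
  · by_contra! hlt
    refine (minpoly.monic hint).ne_zero (hp _ ?_ (minpoly.aeval K[X] p))
    exact degree_le_natDegree.trans_lt (by exact_mod_cast hlt)

/-! ### Coordinates with respect to a triangular basis. -/

section Triangular

variable {b : ℕ → K[X]} {f : ℕ → K[X][X]} {e : Module.Basis (Fin r) K[X] E}

/-- A polynomial of degree `< m` in `p` is a combination of the first `m` of the `b i • e i`. -/
theorem repr_aeval_of_degree_lt (hfm : ∀ i < r, (f i).Monic) (hfd : ∀ i < r, (f i).natDegree = i)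
    (hbe : ∀ i : Fin r, b i • e i = aeval p (f i)) :
    ∀ m ≤ r, ∀ g : K[X][X], g.degree < (m : ℕ) → ∀ i : Fin r,
      b i ∣ e.repr (aeval p g) i ∧ (m ≤ i → e.repr (aeval p g) i = 0) := by
  intro m
  induction m with
  | zero =>
    intro _ g hg i
    have : g = 0 := degree_eq_bot.1 (by
      rw [Nat.cast_zero] at hg
      exact Nat.WithBot.lt_zero_iff.1 hg)
    simp [this]
  | succ m ih =>
    intro hm g hg i
    have hmr : m < r := hm
    obtain ⟨h1, h2⟩ := ih hmr.le _
      (degree_sub_coeff_smul_lt (hfm m hmr) (hfd m hmr) (degree_le_of_degree_lt_succ hg)) i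
    have h3 : aeval p (f m) = b m • e ⟨m, hmr⟩ := (hbe ⟨m, hmr⟩).symm
    have h4 : aeval p g = aeval p (g - g.coeff m • f m) + g.coeff m • b m • e ⟨m, hmr⟩ := by
      rw [map_sub, map_smul, h3, sub_add_cancel]
    rw [h4, map_add, Finsupp.add_apply]
    by_cases hi : (⟨m, hmr⟩ : Fin r) = i
    · subst hi
      exact ⟨dvd_add h1 (by simp), fun h => by simp at h⟩
    · refine ⟨dvd_add h1 (by simp [hi]), fun h => ?_⟩
      rw [h2 (by omega)]
      simp [hi]

/-- Subtracting `g.coeff i • f i` leaves degree below `i`, which has no coordinate along `e i`. This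
reads off the diagonal entries. -/
theorem repr_aeval_of_degree_le (hfm : ∀ i < r, (f i).Monic) (hfd : ∀ i < r, (f i).natDegree = i)
    (hbe : ∀ i : Fin r, b i • e i = aeval p (f i)) (i : Fin r) {g : K[X][X]}
    (hg : g.degree ≤ ((i : ℕ) : WithBot ℕ)) :
    e.repr (aeval p g) i = g.coeff i * b i := by
  have h1 := degree_sub_coeff_smul_lt (hfm i i.2) (hfd i i.2) hg
  have h2 := (repr_aeval_of_degree_lt hfm hfd hbe i i.2.le _ h1 i).2 le_rfl
  rw [map_sub, map_smul, ← hbe] at h2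
  simpa [sub_eq_zero] using h2

/-- Subtracting the next monic polynomial from `X * f i` kills the leading term. -/
theorem degree_X_mul_sub_le {R : Type*} [CommRing R] {g h : R[X]} {i : ℕ} (hg : g.Monic)
    (hgd : g.natDegree = i) (hh : h.Monic) (hhd : h.natDegree = i + 1) :
    (X * g - h).degree ≤ ((i : ℕ) : WithBot ℕ) := by
  have hg1 := hg.coeff_natDegree
  have hh1 := hh.coeff_natDegree
  rw [hgd] at hg1
  rw [hhd] at hh1
  refine degree_le_of_degree_le_succ ((degree_sub_le _ _).trans (max_le
    (degree_X_mul_le (degree_le_of_natDegree_le hgd.le)) (degree_le_of_natDegree_le hhd.le))) ?_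
  rw [coeff_sub, coeff_X_mul, hg1, hh1, sub_self]

/-- The polynomial `h` is left free so that the minimal polynomial can play the part of `f (i + 1)`
in the last column. -/
theorem mul_eq_add_of_triangular {i : ℕ} (hi : i < r) (h : K[X][X])
    (hbe : ∀ i : Fin r, b i • e i = aeval p (f i)) :
    b i • (p * e ⟨i, hi⟩) = aeval p h + aeval p (X * f i - h) := by
  have := hbe ⟨i, hi⟩
  simp only at this
  rw [← mul_smul_comm, this, map_sub, map_mul, aeval_X, add_sub_cancel]

end Triangular

/-- The span of the powers of `p` in terms of a triangular basis. -/
theorem mem_adjoin_iff_dvd_repr {b : ℕ → K[X]} {f : ℕ → K[X][X]} {e : Module.Basis (Fin r) K[X] E}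
    (hint : IsIntegral K[X] p) (hdeg : (minpoly K[X] p).natDegree = r)
    (hfm : ∀ i < r, (f i).Monic) (hfd : ∀ i < r, (f i).natDegree = i)
    (hbe : ∀ i : Fin r, b i • e i = aeval p (f i)) (u : E) :
    u ∈ Algebra.adjoin K[X] {p} ↔ ∀ i : Fin r, b i ∣ e.repr u i := by
  constructor
  · intro hu
    rw [Algebra.adjoin_singleton_eq_range_aeval] at hu
    obtain ⟨g, rfl⟩ := hu
    change ∀ i : Fin r, b i ∣ e.repr (aeval p g) i
    -- Reduction modulo the minimal polynomial brings the degree below `r`, where the triangular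
    -- coordinates apply.
    have hmod : aeval p g = aeval p (g %ₘ minpoly K[X] p) := by
      conv_lhs => rw [← modByMonic_add_div g (minpoly K[X] p)]
      rw [map_add, map_mul, minpoly.aeval, zero_mul, add_zero]
    have hmdeg : (g %ₘ minpoly K[X] p).degree < r := by
      have h := degree_modByMonic_lt g (minpoly.monic hint)
      rwa [degree_eq_natDegree (minpoly.monic hint).ne_zero, hdeg] at h
    rw [hmod]
    exact fun i => (repr_aeval_of_degree_lt hfm hfd hbe r le_rfl _ hmdeg i).1
  · intro h
    rw [← e.sum_repr u]
    refine Subalgebra.sum_mem _ fun i _ => ?_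
    obtain ⟨c, hc⟩ := h i
    rw [hc, mul_comm, mul_smul, hbe]
    exact Subalgebra.smul_mem _ (by
      rw [Algebra.adjoin_singleton_eq_range_aeval]; exact ⟨f i, rfl⟩) c

end PowersOfElement

/-! ### Degree and zeros of twisted polynomials. -/

namespace TwistedPoly

variable {Fq k : Type*} [Field Fq] [Fintype Fq] [Field k] [Algebra Fq k]

@[ext]
theorem ext {u v : TwistedPoly Fq k} (h : ∀ n, u.coeff n = v.coeff n) : u = v :=
  SkewPolynomial.ext h

theorem coeff_add (u v : TwistedPoly Fq k) (n : ℕ) :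
    (u + v).coeff n = u.coeff n + v.coeff n :=
  SkewPolynomial.coeff_add u v n

theorem coeff_zero (n : ℕ) : (0 : TwistedPoly Fq k).coeff n = 0 := rfl

theorem coeff_smul (c : Fq) (u : TwistedPoly Fq k) (n : ℕ) :
    (c • u).coeff n = c • u.coeff n := rfl

variable (Fq k) in
/-- Taking the `n`-th coefficient is additive. -/
def coeffHom (n : ℕ) : TwistedPoly Fq k →+ k where
  toFun u := u.coeff n
  map_zero' := rfl
  map_add' u v := coeff_add u v n

theorem coeff_sum {ι : Type*} (s : Finset ι) (u : ι → TwistedPoly Fq k) (n : ℕ) :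
    (∑ i ∈ s, u i).coeff n = ∑ i ∈ s, (u i).coeff n :=
  map_sum (coeffHom Fq k n) u s

theorem coeff_sub (u v : TwistedPoly Fq k) (n : ℕ) :
    (u - v).coeff n = u.coeff n - v.coeff n :=
  map_sub (coeffHom Fq k n) u v

variable (Fq) in
/-- The twisted polynomial `c τ ^ n`. -/
def monomial (n : ℕ) (c : k) : TwistedPoly Fq k :=
  (SkewMonoidAlgebra.single (Multiplicative.ofAdd n) c : SkewMonoidAlgebra k (Multiplicative ℕ))

theorem coeff_monomial (n m : ℕ) (c : k) :
    (monomial Fq n c).coeff m = if n = m then c else 0 :=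
  SkewPolynomial.coeff_monomial

theorem monomial_mul_monomial (m n : ℕ) (a b : k) :
    monomial Fq m a * monomial Fq n b = monomial Fq (m + n) (a * b ^ Fintype.card Fq ^ m) := by
  let _ := frobeniusAction Fq k
  have h : (Multiplicative.ofAdd m) • b = b ^ Fintype.card Fq ^ m := frobenius_pow_apply Fq m b
  rw [← h]
  exact SkewMonoidAlgebra.single_mul_single

theorem induction_on {p : TwistedPoly Fq k → Prop} (u : TwistedPoly Fq k) (zero : p 0)
    (mono : ∀ n c, p (monomial Fq n c)) (add : ∀ u v, p u → p v → p (u + v)) : p u :=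
  SkewMonoidAlgebra.induction_on (p := p) u zero (fun n c => mono (Multiplicative.toAdd n) c)
    (fun {f g} => add f g)

theorem exists_coeff_eq_zero (u : TwistedPoly Fq k) : ∃ n, ∀ i, n ≤ i → u.coeff i = 0 := by
  induction u using induction_on with
  | zero => exact ⟨0, fun i _ => coeff_zero i⟩
  | mono n c =>
    exact ⟨n + 1, fun i hi => by rw [coeff_monomial, if_neg (by omega)]⟩
  | add u v hu hv =>
    obtain ⟨m, hm⟩ := hu
    obtain ⟨n, hn⟩ := hv
    exact ⟨max m n, fun i hi => by
      rw [coeff_add, hm i (le_of_max_le_left hi), hn i (le_of_max_le_right hi), add_zero]⟩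

theorem eq_sum_monomial {u : TwistedPoly Fq k} {n : ℕ} (hu : ∀ i, n ≤ i → u.coeff i = 0) :
    u = ∑ i ∈ Finset.range n, monomial Fq i (u.coeff i) := by
  ext m
  rw [coeff_sum]
  simp only [coeff_monomial, Finset.sum_ite_eq', Finset.mem_range]
  split_ifs with h
  · rfl
  · exact hu m (by omega)

theorem coeff_monomial_mul (m : ℕ) (a : k) (v : TwistedPoly Fq k) (n : ℕ) :
    (monomial Fq m a * v).coeff n =
      if m ≤ n then a * v.coeff (n - m) ^ Fintype.card Fq ^ m else 0 := by
  induction v using induction_on with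
  | zero =>
    rw [mul_zero, coeff_zero, coeff_zero, zero_pow (pow_ne_zero _ Fintype.card_ne_zero), mul_zero,
      ite_self]
  | mono i c =>
    rw [monomial_mul_monomial, coeff_monomial, coeff_monomial]
    by_cases h : m ≤ n
    · by_cases h' : i = n - m
      · rw [if_pos (by omega), if_pos h, if_pos h']
      · rw [if_neg (by omega), if_pos h, if_neg h',
          zero_pow (pow_ne_zero _ Fintype.card_ne_zero), mul_zero]
    · rw [if_neg (by omega), if_neg h]
  | add u v hu hv =>
    rw [mul_add, coeff_add, hu, hv, coeff_add]
    split_ifs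
    · rw [← mul_add]
      congr 1
      simp only [← frobenius_pow_apply Fq m, map_add]
    · rw [add_zero]

/-- Only the product of the two top terms reaches degree `m + n`. As a power of Frobenius kills no
nonzero element of `k`, degrees add and `k{τ}` has no zero divisors. -/
theorem coeff_mul_of_le {u v : TwistedPoly Fq k} {m n : ℕ} (hu : ∀ i, m < i → u.coeff i = 0)
    (hv : ∀ i, n < i → v.coeff i = 0) :
    (u * v).coeff (m + n) = u.coeff m * v.coeff n ^ Fintype.card Fq ^ m ∧
      ∀ i, m + n < i → (u * v).coeff i = 0 := by
  have hu' := eq_sum_monomial (n := m + 1) hu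
  have key : ∀ i, (u * v).coeff i = ∑ j ∈ Finset.range (m + 1),
      if j ≤ i then u.coeff j * v.coeff (i - j) ^ Fintype.card Fq ^ j else 0 := by
    intro i
    have hs : u * v = ∑ j ∈ Finset.range (m + 1), monomial Fq j (u.coeff j) * v :=
      (congrArg (· * v) hu').trans (Finset.sum_mul _ _ _)
    rw [hs, coeff_sum]
    simp only [coeff_monomial_mul]
  have hz : ∀ j, (0 : k) ^ Fintype.card Fq ^ j = 0 := fun j =>
    zero_pow (pow_ne_zero _ Fintype.card_ne_zero)
  refine ⟨?_, fun i hi => ?_⟩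
  · rw [key, Finset.sum_eq_single m]
    · rw [if_pos (by omega), Nat.add_sub_cancel_left]
    · intro j hj hjm
      have := Finset.mem_range.1 hj
      rw [hv (m + n - j) (by omega), hz, mul_zero, ite_self]
    · intro h
      exact absurd (Finset.mem_range.2 (by omega)) h
  · rw [key]
    refine Finset.sum_eq_zero fun j hj => ?_
    have := Finset.mem_range.1 hj
    rw [hv (i - j) (by omega), hz, mul_zero, ite_self]

/-- `u` is nonzero of degree `n` in `τ`. -/
structure HasDegree (u : TwistedPoly Fq k) (n : ℕ) : Prop where
  coeff_ne_zero : u.coeff n ≠ 0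
  coeff_eq_zero : ∀ i, n < i → u.coeff i = 0

theorem HasDegree.mul {u v : TwistedPoly Fq k} {m n : ℕ} (hu : u.HasDegree m)
    (hv : v.HasDegree n) : (u * v).HasDegree (m + n) := by
  obtain ⟨h1, h2⟩ := coeff_mul_of_le hu.coeff_eq_zero hv.coeff_eq_zero
  exact ⟨by rw [h1]; exact mul_ne_zero hu.coeff_ne_zero (pow_ne_zero _ hv.coeff_ne_zero), h2⟩

theorem HasDegree.ne_zero {u : TwistedPoly Fq k} {n : ℕ} (hu : u.HasDegree n) : u ≠ 0 := by
  rintro rfl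
  exact hu.coeff_ne_zero (coeff_zero n)

theorem exists_hasDegree {u : TwistedPoly Fq k} (hu : u ≠ 0) : ∃ n, u.HasDegree n := by
  classical
  have hex := u.exists_coeff_eq_zero
  have hpos : Nat.find hex ≠ 0 := fun h0 => hu (by
    ext n
    exact Nat.find_spec hex n (by omega))
  refine ⟨Nat.find hex - 1, fun h => ?_, fun i hi => Nat.find_spec hex i (by omega)⟩
  refine Nat.find_min hex (m := Nat.find hex - 1) (by omega) fun i hi => ?_
  rcases hi.eq_or_lt with rfl | hi
  · exact h
  · exact Nat.find_spec hex i (by omega)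

theorem hasDegree_one : (1 : TwistedPoly Fq k).HasDegree 0 := by
  have h1 : (1 : TwistedPoly Fq k) = monomial Fq 0 1 := rfl
  refine ⟨?_, fun i hi => ?_⟩
  · rw [h1, coeff_monomial, if_pos rfl]
    exact one_ne_zero
  · rw [h1, coeff_monomial, if_neg (by omega)]

theorem HasDegree.pow {u : TwistedPoly Fq k} {m : ℕ} (hu : u.HasDegree m) (j : ℕ) :
    (u ^ j).HasDegree (j * m) := by
  induction j with
  | zero => simpa using hasDegree_one
  | succ j ih =>
    rw [pow_succ, add_mul, one_mul]
    exact ih.mul hu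

instance instNontrivial : Nontrivial (TwistedPoly Fq k) :=
  ⟨⟨1, 0, hasDegree_one.ne_zero⟩⟩

instance instNoZeroDivisors : NoZeroDivisors (TwistedPoly Fq k) where
  eq_zero_or_eq_zero_of_mul_eq_zero {u v} h := by
    by_contra! hne
    obtain ⟨m, hm⟩ := exists_hasDegree hne.1
    obtain ⟨n, hn⟩ := exists_hasDegree hne.2
    exact (hm.mul hn).ne_zero h

theorem evalHom_apply {u : TwistedPoly Fq k} {n : ℕ} (hu : ∀ i, n ≤ i → u.coeff i = 0)
    (z : AlgebraicClosure k) :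
    evalHom Fq k u z = ∑ i ∈ Finset.range n,
      algebraMap k (AlgebraicClosure k) (u.coeff i) * z ^ Fintype.card Fq ^ i := by
  conv_lhs => rw [eq_sum_monomial hu]
  rw [map_sum, LinearMap.sum_apply]
  exact Finset.sum_congr rfl fun i _ => evalHom_single _ _ _

/-- A twisted polynomial of degree `n` has at most `q ^ n` zeros. -/
theorem HasDegree.finite_ncard_zeros {u : TwistedPoly Fq k} {n : ℕ} (hu : u.HasDegree n) :
    {z | evalHom Fq k u z = 0}.Finite ∧
      {z | evalHom Fq k u z = 0}.ncard ≤ Fintype.card Fq ^ n := by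
  classical
  have hq : 1 < Fintype.card Fq := Fintype.one_lt_card
  let P : (AlgebraicClosure k)[X] := ∑ i ∈ Finset.range (n + 1),
    Polynomial.monomial (Fintype.card Fq ^ i) (algebraMap k (AlgebraicClosure k) (u.coeff i))
  have hPe : ∀ z, P.eval z = evalHom Fq k u z := by
    intro z
    rw [evalHom_apply (n := n + 1) hu.coeff_eq_zero, Polynomial.eval_finsetSum]
    simp only [Polynomial.eval_monomial]
  have hPd : P.natDegree ≤ Fintype.card Fq ^ n := by
    refine Polynomial.natDegree_sum_le_of_forall_le _ _ fun i hi => ?_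
    refine (Polynomial.natDegree_monomial_le _).trans (Nat.pow_le_pow_right hq.le ?_)
    have := Finset.mem_range.1 hi
    omega
  have hP0 : P ≠ 0 := by
    intro h
    -- The exponents `q ^ i` are distinct, so no other term meets the top one.
    have h1 : P.coeff (Fintype.card Fq ^ n) = algebraMap k (AlgebraicClosure k) (u.coeff n) := by
      rw [Polynomial.finsetSum_coeff, Finset.sum_eq_single n]
      · rw [Polynomial.coeff_monomial, if_pos rfl]
      · intro j _ hj
        rw [Polynomial.coeff_monomial, if_neg]
        exact fun h => hj (Nat.pow_right_injective hq h)
      · intro h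
        exact absurd (Finset.mem_range.2 (by omega)) h
    rw [h, Polynomial.coeff_zero] at h1
    exact hu.coeff_ne_zero ((map_eq_zero _).1 h1.symm)
  have hset : {z | evalHom Fq k u z = 0} = (P.roots.toFinset : Set (AlgebraicClosure k)) := by
    ext z
    simp [hP0, hPe]
  rw [hset]
  refine ⟨Finset.finite_toSet _, ?_⟩
  rw [Set.ncard_coe_finset]
  exact (Multiset.toFinset_card_le _).trans ((Polynomial.card_roots' _).trans hPd)

end TwistedPoly

/-! ### Finiteness of the endomorphism ring over `A` and size of the torsion. -/

namespace DrinfeldModule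

variable {Fq k : Type*} [Field Fq] [Fintype Fq] [Field k] [Algebra Fq k]
  {γ : Fq[X] →ₐ[Fq] k} {r : ℕ} (φ : DrinfeldModule γ r)

theorem hasDegree_X : (φ.toAlgHom Polynomial.X).HasDegree r :=
  ⟨φ.coeff_rank_ne_zero, φ.coeff_eq_zero⟩

/-- The powers of `φ_T` have degrees `j * r`, distinct because `r ≥ 1`, so the leading term of `a`
dominates. Torsion-freeness of the endomorphism ring and the bound on torsion both come from this.
-/
theorem hasDegree_toAlgHom {a : Fq[X]} (ha : a ≠ 0) :
    (φ.toAlgHom a).HasDegree (a.natDegree * r) := by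
  have hpow := fun j => (φ.hasDegree_X).pow j
  have key : ∀ i, (φ.toAlgHom a).coeff i = ∑ j ∈ Finset.range (a.natDegree + 1),
      a.coeff j • (φ.toAlgHom Polynomial.X ^ j).coeff i := by
    intro i
    conv_lhs => rw [a.as_sum_range_C_mul_X_pow]
    rw [map_sum, TwistedPoly.coeff_sum]
    refine Finset.sum_congr rfl fun j _ => ?_
    rw [← TwistedPoly.coeff_smul, ← map_pow, ← map_smul, Polynomial.smul_eq_C_mul]
  have hr := φ.one_le_rank
  refine ⟨?_, fun i hi => ?_⟩
  · rw [key, Finset.sum_eq_single a.natDegree]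
    · exact smul_ne_zero (Polynomial.leadingCoeff_ne_zero.2 ha) (hpow _).coeff_ne_zero
    · intro j hj hne
      have := Finset.mem_range.1 hj
      rw [(hpow j).coeff_eq_zero, smul_zero]
      exact Nat.mul_lt_mul_of_pos_right (by omega) hr
    · intro h
      exact absurd (Finset.mem_range.2 (by omega)) h
  · rw [key]
    refine Finset.sum_eq_zero fun j hj => ?_
    have := Finset.mem_range.1 hj
    rw [(hpow j).coeff_eq_zero, smul_zero]
    exact lt_of_le_of_lt (Nat.mul_le_mul_right r (by omega)) hi

instance instNontrivialEndRing : Nontrivial φ.endRing :=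
  inferInstanceAs (Nontrivial φ.endRing.toSubring)

instance instIsTorsionFreeEndRing : Module.IsTorsionFree Fq[X] φ.endRing :=
  .of_smul_eq_zero fun a u h => by
    have h1 : φ.toAlgHom a * (u : TwistedPoly Fq k) = 0 := congrArg Subtype.val h
    rcases mul_eq_zero.1 h1 with h2 | h2
    · left
      by_contra ha
      exact (φ.hasDegree_toAlgHom ha).ne_zero h2
    · exact Or.inr (Subtype.ext h2)

/-- `k{τ}` as a module over `A` on which `a` acts by multiplication by `φ_a` on the left. -/
def TwistedModule (_ : DrinfeldModule γ r) : Type _ := TwistedPoly Fq k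

instance instAddCommGroupTwistedModule : AddCommGroup φ.TwistedModule :=
  inferInstanceAs (AddCommGroup (TwistedPoly Fq k))

instance instModuleTwistedPolyTwistedModule : Module (TwistedPoly Fq k) φ.TwistedModule :=
  inferInstanceAs (Module (TwistedPoly Fq k) (TwistedPoly Fq k))

instance instModuleTwistedModule : Module Fq[X] φ.TwistedModule :=
  Module.compHom _ (φ.toAlgHom : Fq[X] →+* TwistedPoly Fq k)

/-- The identity map from `k{τ}` to itself as an `A`-module. -/
def toTwistedModule : TwistedPoly Fq k ≃+ φ.TwistedModule := AddEquiv.refl _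

theorem toTwistedModule_mul (a : Fq[X]) (u : TwistedPoly Fq k) :
    φ.toTwistedModule (φ.toAlgHom a * u) = a • φ.toTwistedModule u := rfl

/-- Division by `φ_T` on the left is possible because the finite field `k` is perfect; the
remainders of degree below `r` form a finite generating set. -/
instance instFiniteTwistedModule [Finite k] : Module.Finite Fq[X] φ.TwistedModule := by
  let S : Set (TwistedPoly Fq k) := {u | ∀ i, r ≤ i → u.coeff i = 0}
  have hS : S.Finite := by
    refine Set.Finite.of_finite_image (f := fun u (i : Fin r) => u.coeff i) (Set.toFinite _) ?_
    intro u hu v hv huv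
    refine TwistedPoly.ext fun n => ?_
    rcases Nat.lt_or_ge n r with h | h
    · exact congrFun huv ⟨n, h⟩
    · rw [hu n h, hv n h]
  have hr := φ.one_le_rank
  have hsurj : Function.Surjective fun d : k =>
      (φ.toAlgHom Polynomial.X).coeff r * d ^ Fintype.card Fq ^ r := by
    apply Finite.surjective_of_injective
    intro x y hxy
    have h := mul_left_cancel₀ φ.coeff_rank_ne_zero hxy
    rw [← TwistedPoly.frobenius_pow_apply, ← TwistedPoly.frobenius_pow_apply] at h
    exact RingHom.injective _ h
  have key : ∀ n, ∀ u : TwistedPoly Fq k, (∀ i, n ≤ i → u.coeff i = 0) →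
      φ.toTwistedModule u ∈ Submodule.span Fq[X] (φ.toTwistedModule '' S) := by
    intro n
    induction n using Nat.strong_induction_on with
    | _ n ih =>
      intro u hu
      rcases Nat.lt_or_ge r n with hrn | hrn
      -- This `d` makes `φ_T * d τ ^ (n - 1 - r)` match `u` in degree `n - 1`; both the difference
      -- and the monomial fall under the induction hypothesis.
      · obtain ⟨d, hd⟩ := hsurj (u.coeff (n - 1))
        simp only at hd
        have hv : ∀ i, n - 1 - r < i → (TwistedPoly.monomial Fq (n - 1 - r) d).coeff i = 0 :=
          fun i hi => by rw [TwistedPoly.coeff_monomial, if_neg (by omega)]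
        obtain ⟨h1, h2⟩ := TwistedPoly.coeff_mul_of_le φ.coeff_eq_zero hv
        rw [TwistedPoly.coeff_monomial, if_pos rfl, hd] at h1
        have hw := ih (n - 1) (by omega)
          (u - φ.toAlgHom Polynomial.X * TwistedPoly.monomial Fq (n - 1 - r) d) (fun i hi => by
            rw [TwistedPoly.coeff_sub]
            rcases hi.eq_or_lt with rfl | hi
            · rw [← h1, sub_eq_zero]
              congr 1
              omega
            · rw [hu i (by omega), h2 i (by omega), sub_zero])
        have hm := ih (n - 1 - r + 1) (by omega) _ hv
        rw [← sub_add_cancel u (φ.toAlgHom Polynomial.X * TwistedPoly.monomial Fq (n - 1 - r) d),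
          map_add, toTwistedModule_mul]
        exact Submodule.add_mem _ hw (Submodule.smul_mem _ Polynomial.X hm)
      · exact Submodule.subset_span ⟨u, fun i hi => hu i (hrn.trans hi), rfl⟩
  refine Module.finite_def.2 (Submodule.fg_def.2 ⟨_, hS.image φ.toTwistedModule, eq_top_iff.2 ?_⟩)
  intro u _
  obtain ⟨u, rfl⟩ := φ.toTwistedModule.surjective u
  obtain ⟨n, hn⟩ := u.exists_coeff_eq_zero
  exact key n u hn

instance instFiniteEndRing [Finite k] : Module.Finite Fq[X] φ.endRing := by
  let i : φ.endRing →ₗ[Fq[X]] φ.TwistedModule :=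
    { toFun := fun u => φ.toTwistedModule u
      map_add' := fun _ _ => rfl
      map_smul' := fun _ _ => rfl }
  -- The endomorphism ring is a submodule of a finite module over the Noetherian ring `A`.
  exact Module.Finite.of_injective i Subtype.val_injective

theorem finite_ncard_torsion {a : Fq[X]} (ha : a ≠ 0) :
    {x : φ.Kbar | a • x = 0}.Finite ∧
      {x : φ.Kbar | a • x = 0}.ncard ≤ Fintype.card Fq ^ (a.natDegree * r) :=
  (φ.hasDegree_toAlgHom ha).finite_ncard_zeros

end DrinfeldModule

/-! ### Independence of the powers of Frobenius, from the degree of `K` over `F`. -/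

section Independence

open Polynomial

variable {K E : Type*} [Field K] [Ring E] [Algebra K[X] E] {p : E} {r : ℕ}

/-- Over the fraction field a nonzero relation can be made monic, and then fewer than `r` powers
would span the adjoined algebra. -/
theorem eq_zero_of_finrank_adjoin_eq
    (h : Module.finrank (FractionRing K[X])
      (Algebra.adjoin (FractionRing K[X])
        {((1 : FractionRing K[X]) ⊗ₜ[K[X]] p : FractionRing K[X] ⊗[K[X]] E)}) = r)
    (g : K[X][X]) (hg : g.degree < r) (hgp : aeval p g = 0) : g = 0 := by
  classical
  by_contra hg0
  set F := FractionRing K[X]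
  set x : F ⊗[K[X]] E := (1 : F) ⊗ₜ[K[X]] p with hx
  let G : F[X] := g.map (algebraMap K[X] F)
  have hinj : Function.Injective (algebraMap K[X] F) := IsFractionRing.injective _ _
  have hG0 : G ≠ 0 := (Polynomial.map_ne_zero_iff hinj).2 hg0
  have hGx : aeval x G = 0 := by
    rw [aeval_map_algebraMap]
    have h1 := aeval_algHom_apply (Algebra.TensorProduct.includeRight : E →ₐ[K[X]] F ⊗[K[X]] E) p g
    rw [hgp, map_zero] at h1
    exact h1
  have hmon : (G * C G.leadingCoeff⁻¹).Monic := monic_mul_leadingCoeff_inv hG0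
  have hspan := Submodule.span_range_natDegree_eq_adjoin hmon
    (x := x) (by rw [map_mul, hGx, zero_mul])
  have hle := finrank_span_finset_le_card (R := F)
    (Finset.image (fun i => x ^ i) (Finset.range (G * C G.leadingCoeff⁻¹).natDegree))
  rw [Set.finrank, hspan] at hle
  have hcard := hle.trans Finset.card_image_le
  rw [Finset.card_range, natDegree_mul_C (inv_ne_zero (leadingCoeff_ne_zero.2 hG0)),
    natDegree_map_eq_of_injective hinj] at hcard
  have hlt : g.natDegree < r := (natDegree_lt_iff_degree_lt hg0).2 hg
  have : r ≤ g.natDegree := h ▸ hcard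
  omega

theorem le_finrank_of_injective_aeval [Module.Finite K[X] E]
    (hp : ∀ g : K[X][X], g.degree < r → aeval p g = 0 → g = 0) :
    r ≤ Module.finrank K[X] E := by
  let T : K[X][X] →ₗ[K[X]] E := (aeval p).toLinearMap
  have hinj : Function.Injective (T.domRestrict (degreeLT K[X] r)) := by
    rw [injective_iff_map_eq_zero]
    rintro ⟨g, hg⟩ h
    exact Subtype.ext (hp g (mem_degreeLT.1 hg) h)
  have h := LinearMap.finrank_le_finrank_of_injective hinj
  rw [(degreeLTEquiv K[X] r).finrank_eq] at h
  simpa using h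

end Independence

/-! ### The Tate module: action of Frobenius and the upper bound on the rank. -/

namespace DrinfeldModule

variable {Fq k : Type*} [Field Fq] [Fintype Fq] [Field k] [Algebra Fq k]
  {γ : Fq[X] →ₐ[Fq] k} {r : ℕ} (φ : DrinfeldModule γ r) {l : Fq[X]}

theorem residue_surjective {Fq : Type*} [Field Fq] {l : Fq[X]} (n : ℕ) : Function.Surjective (residue l n) :=
  AdicCompletion.surjective_evalₐ _ n

variable {φ} in
/-- An isomorphism over `A_𝔩 ⊗ End(φ)` is one over `A_𝔩`. -/
def restrictCompletion
    (ψ : φ.TateModule l ≃ₗ[completion l ⊗[Fq[X]] φ.endRing] (completion l ⊗[Fq[X]] φ.endRing)) :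
    φ.TateModule l ≃ₗ[completion l] (completion l ⊗[Fq[X]] φ.endRing) :=
  { ψ.toAddEquiv with
    map_smul' := fun a x => by
      have h1 : (a ⊗ₜ[Fq[X]] (1 : φ.endRing)) • x = a • x := by
        rw [TensorProduct.Algebra.smul_def, one_smul]
      have h2 := ψ.map_smul (a ⊗ₜ[Fq[X]] (1 : φ.endRing)) x
      rw [h1, smul_eq_mul] at h2
      refine h2.trans ?_
      rw [RingHom.id_apply, Algebra.smul_def, Algebra.TensorProduct.algebraMap_apply]
      rfl }

/-- Since `q ^ [k : Fq] = #k`, the endomorphism `π` acts on `k̄` as `x ↦ x ^ #k`, so the Galois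
action of Frobenius is scalar multiplication by `1 ⊗ π`, with which `ψ` commutes. -/
theorem restrictCompletion_frobTate [Fintype k]
    (ψ : φ.TateModule l ≃ₗ[completion l ⊗[Fq[X]] φ.endRing] (completion l ⊗[Fq[X]] φ.endRing))
    (x : φ.TateModule l) :
    restrictCompletion ψ (φ.frobTate l x) =
      ((1 : completion l) ⊗ₜ[Fq[X]] φ.frobenius) * restrictCompletion ψ x := by
  have h1 : φ.frobTate l x = φ.frobenius • x := by
    ext n
    have hq : Fintype.card Fq ^ Module.finrank Fq k = Fintype.card k :=
      (Module.card_eq_pow_finrank (K := Fq) (V := k)).symm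
    have htau : TwistedPoly.tau Fq k ^ Module.finrank Fq k =
        TwistedPoly.monomial Fq (Module.finrank Fq k) 1 := by
      let _ := frobeniusAction Fq k
      exact (SkewPolynomial.monomial_one_right_eq_X_pow _).symm
    change (FiniteField.frobeniusAlgEquivOfAlgebraic k (AlgebraicClosure k) (x.1 n) :
      AlgebraicClosure k) = TwistedPoly.evalHom Fq k (TwistedPoly.tau Fq k ^ Module.finrank Fq k) _
    rw [htau]
    refine Eq.trans ?_ (TwistedPoly.evalHom_single _ _ _).symm
    rw [map_one, one_mul, toAdd_ofAdd, hq]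
    rfl
  have h2 : ((1 : completion l) ⊗ₜ[Fq[X]] φ.frobenius) • x = φ.frobenius • x := by
    rw [TensorProduct.Algebra.smul_def, one_smul]
  rw [h1, ← h2]
  exact ψ.map_smul _ x

theorem exists_basis_toMatrix_frobTate [Fintype k]
    (ψ : φ.TateModule l ≃ₗ[completion l ⊗[Fq[X]] φ.endRing] (completion l ⊗[Fq[X]] φ.endRing))
    (e : Module.Basis (Fin r) Fq[X] φ.endRing) :
    ∃ B : Module.Basis (Fin r) (completion l) (φ.TateModule l),
      LinearMap.toMatrix B B (φ.frobTate l) =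
        (φ.frobeniusMatrix e).map (algebraMap Fq[X] (completion l)) := by
  refine ⟨(Algebra.TensorProduct.basis (completion l) e).map (restrictCompletion ψ).symm, ?_⟩
  ext i j
  rw [LinearMap.toMatrix_apply, Module.Basis.map_repr, LinearEquiv.trans_apply,
    LinearEquiv.symm_symm, restrictCompletion_frobTate, Module.Basis.map_apply,
    LinearEquiv.apply_symm_apply, Algebra.TensorProduct.basis_apply,
    Algebra.TensorProduct.tmul_mul_tmul, one_mul, Algebra.TensorProduct.basis_repr_tmul]
  rw [Matrix.map_apply, frobeniusMatrix, LinearMap.toMatrix_apply]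
  rw [one_smul, Finsupp.mapRange_apply]
  rfl

/-- The witness is the shifted sequence `x (n + 1)`; it is torsion of the right order because `l ^ n
• x (n + 1) = x 1 = 0`. Thus `T / lT` embeds in `φ[𝔩]`. -/
theorem eq_smul_of_apply_one_eq_zero {x : φ.TateModule l} (hx : x.1 1 = 0) :
    ∃ y : φ.TateModule l, x = l • y := by
  refine ⟨⟨fun n => x.1 (n + 1), fun n => ?_, fun n => x.2.2 (n + 1)⟩, ?_⟩
  · induction n with
    | zero => simpa using hx
    | succ n ih => rw [pow_succ, mul_smul, x.2.2 (n + 1), ih]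
  · ext n
    exact (x.2.2 n).symm

theorem card_quotient_span {Fq : Type*} [Field Fq] [Fintype Fq] (l : Fq[X]) (hl : l ≠ 0) :
    Nat.card (Fq[X] ⧸ Ideal.span {l}) = Fintype.card Fq ^ l.natDegree := by
  have : Module.Finite Fq (Fq[X] ⧸ Ideal.span {l}) :=
    (AdjoinRoot.powerBasis (K := Fq) (f := l) hl).finite
  rw [Module.natCard_eq_pow_finrank (K := Fq), finrank_quotient_span_eq_natDegree,
    Nat.card_eq_fintype_card]

/-- If the Tate module is free of rank one over `A_𝔩 ⊗ End(φ)`, then `End(φ)` has rank at most `r`,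
since `φ[𝔩]` has at most `(#A/𝔩) ^ r` elements. -/
theorem finrank_endRing_le [Finite k] (hl : Irreducible l)
    (ψ : φ.TateModule l ≃ₗ[completion l ⊗[Fq[X]] φ.endRing] (completion l ⊗[Fq[X]] φ.endRing)) :
    Module.finrank Fq[X] φ.endRing ≤ r := by
  let e := Module.finBasis Fq[X] φ.endRing
  set s := Module.finrank Fq[X] φ.endRing
  let B := (Algebra.TensorProduct.basis (completion l) e).map (restrictCompletion ψ).symm
  let g : φ.TateModule l → Fin s → Fq[X] ⧸ Ideal.span {l} ^ 1 :=
    fun x i => residue l 1 (B.repr x i)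
  have hg : Function.Surjective g := by
    intro c
    choose a ha using fun i => residue_surjective (l := l) 1 (c i)
    refine ⟨B.repr.symm (Finsupp.equivFunOnFinite.symm a), funext fun i => ?_⟩
    simp [g, ha]
  -- The coordinates modulo `l` depend only on the component in `φ[𝔩]`, so `φ[𝔩]` has at least as
  -- many elements as `(A/𝔩) ^ s`.
  have hker : ∀ x y : φ.TateModule l, x.1 1 = y.1 1 → g x = g y := by
    intro x y hxy
    obtain ⟨z, hz⟩ := φ.eq_smul_of_apply_one_eq_zero (x := x - y) (by
      change x.1 1 - y.1 1 = 0
      rw [hxy, sub_self])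
    funext i
    have h0 : residue l 1 (B.repr (x - y) i) = 0 := by
      rw [hz, ← algebraMap_smul (completion l) l z, map_smul, Finsupp.smul_apply, smul_eq_mul,
        map_mul, AlgHom.commutes, Ideal.Quotient.algebraMap_eq,
        Ideal.Quotient.eq_zero_iff_mem.2 (by rw [pow_one]; exact Ideal.mem_span_singleton_self l),
        zero_mul]
    rw [map_sub, Finsupp.sub_apply, map_sub, sub_eq_zero] at h0
    exact h0
  obtain ⟨hfin, hcard⟩ := φ.finite_ncard_torsion hl.ne_zero
  let c : (Fin s → Fq[X] ⧸ Ideal.span {l} ^ 1) → {x : φ.Kbar | l • x = 0} := fun v =>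
    ⟨(Function.surjInv hg v).1 1, by simpa using (Function.surjInv hg v).2.1 1⟩
  have hc : Function.Injective c := by
    intro v w hvw
    rw [← Function.surjInv_eq hg v, ← Function.surjInv_eq hg w]
    exact hker _ _ (congrArg Subtype.val hvw)
  have : Finite {x : φ.Kbar | l • x = 0} := hfin
  have h1 := Nat.card_le_card_of_injective c hc
  rw [Nat.card_fun, Nat.card_eq_fintype_card (α := Fin s), Fintype.card_fin, pow_one,
    card_quotient_span l hl.ne_zero, Nat.card_coe_set_eq, ← pow_mul] at h1
  have h2 := (Nat.pow_le_pow_iff_right (Fintype.one_lt_card (α := Fq))).1 (h1.trans hcard)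
  exact Nat.le_of_mul_le_mul_left h2 (Polynomial.natDegree_pos_iff_degree_pos.2
    (Polynomial.degree_pos_of_irreducible hl))

/-! ### The Frobenius basis and the shape of the matrix. -/

theorem exists_isFrobeniusBasis [Fintype k] (hK : φ.FrobeniusDegreeEqRank)
    (hr : Module.finrank Fq[X] φ.endRing = r) :
    ∃ (b : ℕ → Fq[X]) (f : ℕ → Fq[X][X]) (e : Module.Basis (Fin r) Fq[X] φ.endRing),
      φ.IsFrobeniusBasis b f e := by
  have hp := eq_zero_of_finrank_adjoin_eq hK
  obtain ⟨hint, hdeg⟩ := natDegree_minpoly_eq_finrank hr hp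
  obtain ⟨b, f, e, hb0, hf0, hbm, hbd, hfm, hfd, hbe⟩ :=
    exists_triangular_basis hr φ.one_le_rank hp
  have hdvd : ∀ i j, 1 ≤ i → i ≤ j → j < r → b i ∣ b j := by
    intro i j _ hij
    induction j, hij using Nat.le_induction with
    | base => exact fun _ => dvd_rfl
    | succ j _ ih => exact fun hj => (ih (by omega)).trans (hbd j hj)
  refine ⟨b, f, e, ⟨fun i _ hi => hbm i hi, hdvd, ⟨?_⟩⟩, hb0, hf0, fun i _ hi => hfm i hi,
    fun i _ hi => hfd i hi, hbe⟩
  -- Reduce each coordinate modulo its `b i`. The coordinate `0` may be dropped because `b 0 = 1`.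
  let q : φ.endRing →ₗ[Fq[X]] (i : Finset.Ico 1 r) → Fq[X] ⧸ Ideal.span {b i} :=
    LinearMap.pi fun i => (Submodule.mkQ (Ideal.span {b i})).comp
      (e.coord ⟨i, (Finset.mem_Ico.1 i.2).2⟩)
  have hq : ∀ u i, q u i = Ideal.Quotient.mk (Ideal.span {b i})
      (e.repr u ⟨i, (Finset.mem_Ico.1 i.2).2⟩) := fun _ _ => rfl
  have hsurj : Function.Surjective q := by
    intro c
    choose a ha using fun i => Ideal.Quotient.mk_surjective (c i)
    refine ⟨e.equivFun.symm fun i => if h : (i : ℕ) ∈ Finset.Ico 1 r then a ⟨i, h⟩ else 0,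
      funext fun i => ?_⟩
    rw [hq, ← ha i, ← Module.Basis.equivFun_apply, LinearEquiv.apply_symm_apply, dif_pos i.2]
  have hker : LinearMap.ker q = Subalgebra.toSubmodule φ.frobeniusOrder := by
    ext u
    rw [Subalgebra.mem_toSubmodule, mem_adjoin_iff_dvd_repr hint hdeg hfm hfd hbe, LinearMap.mem_ker]
    constructor
    · intro h i
      rcases Nat.eq_zero_or_pos (i : ℕ) with hi | hi
      · rw [hi, hb0]
        exact one_dvd _
      · have h1 := congrFun h ⟨i, Finset.mem_Ico.2 ⟨hi, i.2⟩⟩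
        rw [hq, Pi.zero_apply, Ideal.Quotient.eq_zero_iff_mem, Ideal.mem_span_singleton] at h1
        exact h1
    · intro h
      funext i
      rw [hq, Pi.zero_apply, Ideal.Quotient.eq_zero_iff_mem, Ideal.mem_span_singleton]
      exact h ⟨i, _⟩
  exact (Submodule.quotEquivOfEq _ _ hker.symm).trans (q.quotKerEquivOfSurjective hsurj)

theorem hasFrobeniusShape_frobeniusMatrix [Fintype k] (hK : φ.FrobeniusDegreeEqRank)
    (hr : Module.finrank Fq[X] φ.endRing = r) {b : ℕ → Fq[X]} {f : ℕ → Fq[X][X]}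
    {e : Module.Basis (Fin r) Fq[X] φ.endRing} (h : φ.IsFrobeniusBasis b f e) :
    φ.HasFrobeniusShape b f (φ.frobeniusMatrix e) := by
  have hp := eq_zero_of_finrank_adjoin_eq hK
  obtain ⟨hint, hdeg⟩ := natDegree_minpoly_eq_finrank hr hp
  have hbm : ∀ i < r, (b i).Monic := by
    intro i hi
    rcases Nat.eq_zero_or_pos i with rfl | h0
    · rw [h.b_zero]
      exact Polynomial.monic_one
    · exact h.index.monic i h0 hi
  have hfm : ∀ i < r, (f i).Monic := by
    intro i hi
    rcases Nat.eq_zero_or_pos i with rfl | h0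
    · rw [h.f_zero]
      exact Polynomial.monic_one
    · exact h.f_monic i h0 hi
  have hfd : ∀ i < r, (f i).natDegree = i := by
    intro i hi
    rcases Nat.eq_zero_or_pos i with rfl | h0
    · rw [h.f_zero]
      exact Polynomial.natDegree_one
    · exact h.f_natDegree i h0 hi
  have hbe := h.basis_eq
  have hM : ∀ i j, φ.frobeniusMatrix e i j = e.repr (φ.frobenius * e j) i := fun i j =>
    LinearMap.toMatrix_apply _ _ _ _ _
  -- the polynomial following `f j`, which is the minimal polynomial for `j = r - 1`
  have hnext : ∀ j : Fin r, ∃ F : Fq[X][X], F.Monic ∧ F.natDegree = j + 1 ∧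
      F.coeff j = (if (j : ℕ) + 1 < r then (f (j + 1)).coeff j
        else (minpoly Fq[X] φ.frobenius).coeff j) ∧
      ∀ i : Fin r, e.repr (Polynomial.aeval φ.frobenius F) i =
        if (j : ℕ) + 1 = i then b i else 0 := by
    intro j
    by_cases hj : (j : ℕ) + 1 < r
    · refine ⟨f (j + 1), hfm _ hj, hfd _ hj, (if_pos hj).symm, fun i => ?_⟩
      have h1 := hbe ⟨j + 1, hj⟩
      simp only at h1
      rw [← h1, map_smul, Module.Basis.repr_self, Finsupp.smul_apply, smul_eq_mul]
      by_cases h2 : (j : ℕ) + 1 = i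
      · rw [if_pos h2, Finsupp.single_apply, if_pos (Fin.ext h2), h2, mul_one]
      · rw [if_neg h2, Finsupp.single_apply, if_neg (fun h3 => h2 (congrArg Fin.val h3)), mul_zero]
    · refine ⟨minpoly Fq[X] φ.frobenius, minpoly.monic hint, by omega, (if_neg hj).symm,
        fun i => ?_⟩
      rw [minpoly.aeval, map_zero, Finsupp.zero_apply, if_neg (by omega)]
  -- Here `Q = X * f j - F`, with `F` the polynomial following `f j`. As its degree is at most `j`,
  -- it contributes nothing to the rows below the diagonal; there only `F` counts, and it yields the
  -- subdiagonal.
  have key : ∀ j : Fin r, ∃ Q : Fq[X][X], Q.degree ≤ ((j : ℕ) : WithBot ℕ) ∧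
      Q.coeff j = (if (j : ℕ) = 0 then 0 else (f j).coeff (j - 1)) -
        (if (j : ℕ) + 1 < r then (f (j + 1)).coeff j
          else (minpoly Fq[X] φ.frobenius).coeff j) ∧
      ∀ i : Fin r, b j * φ.frobeniusMatrix e i j =
        (if (j : ℕ) + 1 = i then b i else 0) + e.repr (Polynomial.aeval φ.frobenius Q) i := by
    intro j
    obtain ⟨F, hF, hFd, hFc, hFr⟩ := hnext j
    refine ⟨Polynomial.X * f j - F, degree_X_mul_sub_le (hfm j j.2) (hfd j j.2) hF hFd, ?_,
      fun i => ?_⟩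
    · rw [Polynomial.coeff_sub, hFc]
      congr 1
      rcases Nat.eq_zero_or_pos (j : ℕ) with h0 | h0
      · rw [if_pos h0, h0, Polynomial.coeff_X_mul_zero]
      · rw [if_neg h0.ne']
        conv_lhs => rw [show (j : ℕ) = j - 1 + 1 by omega, Polynomial.coeff_X_mul]
        rw [Nat.sub_add_cancel h0]
    · have h1 : b j • (φ.frobenius * e j) = _ := mul_eq_add_of_triangular j.2 F hbe
      have h2 := congrArg (fun u => e.repr u i) h1
      simp only [map_add, map_smul, Finsupp.smul_apply, Finsupp.add_apply, smul_eq_mul] at h2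
      rw [hM, h2, hFr]
  refine ⟨fun i j hij => ?_, fun i j hij => ?_, fun i => ?_⟩
  · obtain ⟨Q, hQ, -, h1⟩ := key j
    have h2 := h1 i
    rw [if_neg (by omega), zero_add, (repr_aeval_of_degree_lt hfm hfd hbe i i.2.le Q
      (hQ.trans_lt (by exact_mod_cast (show (j : ℕ) < i by omega))) i).2 le_rfl] at h2
    exact (mul_eq_zero.1 h2).resolve_left (hbm j j.2).ne_zero
  · obtain ⟨Q, hQ, -, h1⟩ := key j
    rw [h1, if_pos hij, (repr_aeval_of_degree_lt hfm hfd hbe i i.2.le Q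
      (hQ.trans_lt (by exact_mod_cast (show (j : ℕ) < i by omega))) i).2 le_rfl, add_zero]
  · obtain ⟨Q, hQ, hc, h1⟩ := key i
    have h2 := h1 i
    rw [if_neg (by omega), zero_add, repr_aeval_of_degree_le hfm hfd hbe i hQ, mul_comm] at h2
    rw [← hc]
    exact mul_right_cancel₀ (hbm i i.2).ne_zero h2

end DrinfeldModule

end

theorem mainTheorem4 {Fq k : Type*} [Field Fq] [Fintype Fq] [Field k] [Fintype k] [Algebra Fq k]
    (γ : Fq[X] →ₐ[Fq] k) {r : ℕ} (φ : DrinfeldModule γ r)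
    (hK : φ.FrobeniusDegreeEqRank)
    (l : Fq[X]) (hl : Irreducible l) (hlp : Ideal.span {l} ≠ RingHom.ker γ)
    (hfree : Nonempty (φ.TateModule l ≃ₗ[DrinfeldModule.completion l ⊗[Fq[X]] φ.endRing]
      (DrinfeldModule.completion l ⊗[Fq[X]] φ.endRing))) :
    (∃ (b : ℕ → Fq[X]) (f : ℕ → Fq[X][X]) (e : Module.Basis (Fin r) Fq[X] φ.endRing),
      φ.IsFrobeniusBasis b f e) ∧
    ∀ (b : ℕ → Fq[X]) (f : ℕ → Fq[X][X]) (e : Module.Basis (Fin r) Fq[X] φ.endRing),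
      φ.IsFrobeniusBasis b f e →
        φ.HasFrobeniusShape b f (φ.frobeniusMatrix e) ∧
        ∃ B : Module.Basis (Fin r) (DrinfeldModule.completion l) (φ.TateModule l),
          LinearMap.toMatrix B B (φ.frobTate l) =
            (φ.frobeniusMatrix e).map (algebraMap Fq[X] (DrinfeldModule.completion l)) := by
  obtain ⟨ψ⟩ := hfree
  -- The torsion count bounds the rank above; independence of the powers of `π` bounds it below.
  have hr : Module.finrank Fq[X] φ.endRing = r :=
    le_antisymm (φ.finrank_endRing_le hl ψ)
      (le_finrank_of_injective_aeval (eq_zero_of_finrank_adjoin_eq hK))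
  exact ⟨φ.exists_isFrobeniusBasis hK hr, fun b f e h =>
    ⟨φ.hasFrobeniusShape_frobeniusMatrix hK hr h, φ.exists_basis_toMatrix_frobTate ψ e⟩⟩
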